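/- Conventions. 1-cells of a bicategory are composed in the order of the arrows: for $f\colon X\to Y$ and $h\colon Y\to Z$ the composite is written $f\otimes h\colon X\to Z$. Thus $\mathcal{C}(M,M)$ is a monoidal category under $\otimes$, with unit object the identity 1-cell $1_M$. Vertical composition of 2-cells is written $\circ$ from right to left, and endomorphism rings are taken with respect to $\circ$. Rings and ring homomorphisms are unital. Bialgebroids. Let $R$ and $A$ be rings. A bialgebroid structure over $R$ on $A$ consists of ring homomorphisms $s\colon R\to A$ and $t\colon R^{op}\to A$ with commuting images, which make every right $A$-module $V$ an $R$-$R$-bimodule by $r\cdot v=v\,t(r)$, $v\cdot r=v\,s(r)$ (in particular $A$ itself), and of $R$-$R$-bimodule maps $\gamma\colon A\to A\otimes_R A$ and $\pi\colon A\to R$ forming a comonoid in $_R\mathsf{M}_R$, such that $(s(r)\otimes 1)\gamma(x)=(1\otimes t(r))\gamma(x)$, $\gamma(xy)=\gamma(x)\gamma(y)$, $\gamma(1)=1\otimes 1$, $\pi(1)=1$ and $\pi(t(\pi(x))y)=\pi(xy)=\pi(s(\pi(x))y)$ for all $r\in R$, $x,y\in A$. Then the category $\mathsf{M}_A$ of right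 $A$-modules is monoidal: the product of $V$ and $W$ is $V\otimes_R W$ with $(v\otimes w)x=\sum v\,x_{(1)}\otimes w\,x_{(2)}$, where $\gamma(x)=\sum x_{(1)}\otimes x_{(2)}$; the unit is $R$ with $r\triangleleft x=\pi(s(r)x)$; and the forgetful functor $\phi\colon\mathsf{M}_A\to{}_R\mathsf{M}_R$ is strictly monoidal. Theorem. Let $\mathcal{C}$ be a bicategory (for example, a 2-category) whose hom-categories are additive with all idempotents split and whose horizontal composition is biadditive on 2-cells. Let $a\colon N\to M$ be a 1-cell with a left dual $a^L\colon M\to N$, with unit $\eta\colon 1_N\to a\otimes a^L$ and counit $\varepsilon\colon a^L\otimes a\to 1_M$ satisfying the triangle identities. Assume that $a$ is of depth 2, i.e. $a\otimes a^L\otimes a$ is a direct summand of a finite direct sum of copies of $a$, and that $1_M$ is a direct summand of $g=a^L\otimes a$. Put $R=\mathrm{End}\,a$ and $A=\mathrm{End}\,g$. For $r\in R$ let $r^L\in\mathrm{End}\,a^L$ be its image under the left dual functor, and let $\delta=a^L\otimes\eta\otimes a\colon g\to g\otimes g$. The functor $F=\mathrm{Hom}(g,-)\colon\mathcal{C}(M,M)\to{}_R\mathsf{M}_R$,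 with bimodule structure $r\cdot h=h\circ(r^L\otimes a)$, $h\cdot r=h\circ(a^L\otimes r)$, is regarded as a (lax) monoidal functor by means of $$\mu_{b,c}\colon F(b)\otimes_R F(c)\to F(b\otimes c),\quad x\otimes y\mapsto(x\otimes y)\circ\delta,\qquad \nu\colon R\to F(1_M),\quad r\mapsto\varepsilon\circ(a^L\otimes r).$$ Let $\mathcal{C}_g$ be the full subcategory of $\mathcal{C}(M,M)$ of the direct summands of finite direct sums of copies of $g$. Then $\mathcal{C}_g$ contains $1_M$ and is closed under $\otimes$, so it is a full monoidal subcategory, and there is a unique bialgebroid structure over $R$ on $A$ with the following properties. The category $\mathsf{M}_A^{\mathrm{fgp}}$ of finitely generated projective right $A$-modules contains the unit of $\mathsf{M}_A$ and is closed under its monoidal product; and the functor $G=\mathrm{Hom}(g,-)$, with the $A$-action $h\cdot x=h\circ x$, takes $\mathcal{C}_g$ to $\mathsf{M}_A^{\mathrm{fgp}}$, is an equivalence $\mathcal{C}_g\simeq\mathsf{M}_A^{\mathrm{fgp}}$, and carries a strong monoidal structure such that $$\mathcal{C}_g\xrightarrow{\ G\ }\mathsf{M}_A^{\mathrm{fgp}}\subset\mathsf{M}_A\xrightarrow{\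 \phi\ }{}_R\mathsf{M}_R$$ is, via the identity maps of the groups $\mathrm{Hom}(g,b)$, the monoidal functor $F$ restricted to $\mathcal{C}_g$. In particular $\mathcal{C}_g$ and $\mathsf{M}_A^{\mathrm{fgp}}$ are equivalent as monoidal categories, and $\mathrm{Hom}(g,-)\colon\mathcal{C}_g\to{}_R\mathsf{M}_R$ factorizes, as a monoidal functor, through $\phi$. -/

import Mathlib

universe w v u

open CategoryTheory

/-! ### Bimodules over a (not necessarily commutative) ring -/

/-- An `R`-`R`-bimodule: an abelian group with commuting left and right `R`-actions; the right
action is written as an action of `Rᵐᵒᵖ`. -/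
structure BimodCat (R : Type u) [Ring R] where
  carrier : Type u
  [addCommGroup : AddCommGroup carrier]
  [leftModule : Module R carrier]
  [rightModule : Module Rᵐᵒᵖ carrier]
  [smulComm : SMulCommClass R Rᵐᵒᵖ carrier]

namespace BimodCat

open scoped TensorProduct
open MulOpposite

variable {R : Type u} [Ring R]

instance : CoeSort (BimodCat R) (Type u) := ⟨BimodCat.carrier⟩

attribute [instance] addCommGroup leftModule rightModule smulComm

/-- Homomorphisms of bimodules. -/
@[ext]
structure Hom (X Y : BimodCat R) where
  toAddHom : X →+ Y
  map_smul : ∀ (r : R) (x : X), toAddHom (r • x) = r • toAddHom x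
  map_op_smul : ∀ (r : R) (x : X), toAddHom (op r • x) = op r • toAddHom x

instance : Category (BimodCat R) where
  Hom X Y := Hom X Y
  id X := ⟨AddMonoidHom.id X, fun _ _ => rfl, fun _ _ => rfl⟩
  comp f g := ⟨g.toAddHom.comp f.toAddHom,
    fun r x => by simp [f.map_smul, g.map_smul], fun r x => by simp [f.map_op_smul, g.map_op_smul]⟩

instance (X Y : BimodCat R) : FunLike (X ⟶ Y) X Y where
  coe f := f.toAddHom
  coe_injective _ _ h := Hom.ext (DFunLike.coe_injective h)

instance (X Y : BimodCat R) : AddMonoidHomClass (X ⟶ Y) X Y where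
  map_add f := f.toAddHom.map_add
  map_zero f := f.toAddHom.map_zero

theorem hom_smul {X Y : BimodCat R} (f : X ⟶ Y) (r : R) (x : X) : f (r • x) = r • f x :=
  f.map_smul r x

theorem hom_op_smul {X Y : BimodCat R} (f : X ⟶ Y) (r : R) (x : X) :
    f (op r • x) = op r • f x :=
  f.map_op_smul r x

@[simp] theorem id_apply {X : BimodCat R} (x : X) : (𝟙 X : X ⟶ X) x = x := rfl

@[simp] theorem comp_apply {X Y Z : BimodCat R} (f : X ⟶ Y) (g : Y ⟶ Z) (x : X) :
    (f ≫ g) x = g (f x) := rfl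

theorem hom_ext {X Y : BimodCat R} {f g : X ⟶ Y} (h : ∀ x, f x = g x) : f = g :=
  DFunLike.ext f g h

/-- The morphism of bimodules with a given underlying additive map. -/
def ofHom {X Y : BimodCat R} (f : X →+ Y) (h₁ : ∀ (r : R) (x : X), f (r • x) = r • f x)
    (h₂ : ∀ (r : R) (x : X), f (op r • x) = op r • f x) : X ⟶ Y :=
  ⟨f, h₁, h₂⟩

@[simp] theorem ofHom_apply {X Y : BimodCat R} (f : X →+ Y) (h₁ h₂) (x : X) :
    ofHom f h₁ h₂ x = f x := rfl

/-- The subgroup of `X ⊗_ℤ Y` generated by the elements `x·r ⊗ y - x ⊗ r·y`. -/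
def balanced (X Y : BimodCat R) : AddSubgroup (X ⊗[ℤ] Y) :=
  AddSubgroup.closure
    {z | ∃ (x : X) (r : R) (y : Y), z = (op r • x) ⊗ₜ[ℤ] y - x ⊗ₜ[ℤ] (r • y)}

/-- The abelian group `X ⊗_R Y`. -/
def Tensor (X Y : BimodCat R) : Type u := (X ⊗[ℤ] Y) ⧸ balanced X Y

namespace Tensor

variable {X Y X' Y' X'' Y'' Z : BimodCat R}

instance : AddCommGroup (Tensor X Y) :=
  inferInstanceAs (AddCommGroup ((X ⊗[ℤ] Y) ⧸ balanced X Y))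

/-- The element `x ⊗_R y`. -/
def tmul (x : X) (y : Y) : Tensor X Y := QuotientAddGroup.mk' (balanced X Y) (x ⊗ₜ[ℤ] y)

theorem add_tmul (x x' : X) (y : Y) : tmul (x + x') y = tmul x y + tmul x' y := by
  unfold tmul; rw [TensorProduct.add_tmul, map_add]; rfl

theorem tmul_add (x : X) (y y' : Y) : tmul x (y + y') = tmul x y + tmul x y' := by
  unfold tmul; rw [TensorProduct.tmul_add, map_add]; rfl

theorem smul_tmul (x : X) (r : R) (y : Y) : tmul (op r • x) y = tmul x (r • y) := by
  refine sub_eq_zero.1 ((map_sub (QuotientAddGroup.mk' (balanced X Y)) _ _).symm.trans ?_)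
  exact (QuotientAddGroup.eq_zero_iff _).2 (AddSubgroup.subset_closure ⟨x, r, y, rfl⟩)

theorem induction_on {p : Tensor X Y → Prop} (z : Tensor X Y) (h0 : p 0)
    (ht : ∀ x y, p (tmul x y)) (ha : ∀ z z', p z → p z' → p (z + z')) : p z := by
  obtain ⟨z, rfl⟩ := QuotientAddGroup.mk'_surjective (balanced X Y) z
  induction z using TensorProduct.induction_on with
  | zero => rw [map_zero]; exact h0
  | tmul x y => exact ht x y
  | add z z' h h' => rw [map_add]; exact ha _ _ h h'

/-- The additive map out of `X ⊗_R Y` given by a balanced biadditive map. -/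
def lift {P : Type*} [AddCommGroup P] (f : X →+ Y →+ P)
    (hf : ∀ x (r : R) y, f (op r • x) y = f x (r • y)) : Tensor X Y →+ P :=
  QuotientAddGroup.lift (balanced X Y)
    (TensorProduct.liftAddHom f (fun n x y => by simp)) <| by
      refine (AddSubgroup.closure_le _).2 ?_
      rintro _ ⟨x, r, y, rfl⟩
      simp [AddMonoidHom.mem_ker, hf]

@[simp] theorem lift_tmul {P : Type*} [AddCommGroup P] (f : X →+ Y →+ P)
    (hf : ∀ x (r : R) y, f (op r • x) y = f x (r • y)) (x : X) (y : Y) :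
    lift f hf (tmul x y) = f x y := rfl

theorem addHom_ext {P : Type*} [AddCommGroup P] {f g : Tensor X Y →+ P}
    (h : ∀ x y, f (tmul x y) = g (tmul x y)) : f = g := by
  ext z
  induction z using induction_on with
  | h0 => simp
  | ht x y => exact h x y
  | ha z z' h h' => simp [h, h']

/-- `tmul` as a biadditive map. -/
def tmulHom (X Y : BimodCat R) : X →+ Y →+ Tensor X Y :=
  AddMonoidHom.mk' (fun x => AddMonoidHom.mk' (fun y => tmul x y) (fun y y' => tmul_add x y y'))
    (fun x x' => by ext y; exact add_tmul x x' y)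

@[simp] theorem tmulHom_apply (x : X) (y : Y) : tmulHom X Y x y = tmul x y := rfl

/-- The additive map `f ⊗ g`, where `f` preserves the right and `g` the left `R`-action. -/
def mapAux (f : X →+ X') (g : Y →+ Y') (hf : ∀ (r : R) x, f (op r • x) = op r • f x)
    (hg : ∀ (r : R) y, g (r • y) = r • g y) : Tensor X Y →+ Tensor X' Y' :=
  lift (((AddMonoidHom.compl₂ (tmulHom X' Y') g)).comp f)
    (fun x r y => by simp [hf, hg, smul_tmul])

@[simp] theorem mapAux_tmul (f : X →+ X') (g : Y →+ Y') (hf hg) (x : X) (y : Y) :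
    mapAux f g hf hg (tmul x y) = tmul (f x) (g y) := rfl

/-- The left `R`-action on `X ⊗_R Y`. -/
instance : Module R (Tensor X Y) where
  smul r z := mapAux (DistribSMul.toAddMonoidHom X r) (AddMonoidHom.id Y)
    (fun s x => by simpa using smul_comm r (op s) x) (fun _ _ => rfl) z
  one_smul z := by
    induction z using induction_on with
    | h0 => exact map_zero _
    | ht x y => exact congrArg (tmul · y) (one_smul R x)
    | ha z z' h h' => exact (map_add _ z z').trans (congrArg₂ (· + ·) h h')
  mul_smul r s z := by
    induction z using induction_on with
    | h0 =>
      change mapAux _ _ _ _ 0 = mapAux _ _ _ _ (mapAux _ _ _ _ 0)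
      simp
    | ht x y => exact congrArg (tmul · y) (mul_smul r s x)
    | ha z z' h h' =>
      change mapAux _ _ _ _ _ = mapAux _ _ _ _ (mapAux _ _ _ _ _)
      simp only [map_add]
      exact congrArg₂ (· + ·) h h'
  smul_zero r := map_zero _
  smul_add r z z' := map_add _ z z'
  add_smul r s z := by
    induction z using induction_on with
    | h0 =>
      change mapAux _ _ _ _ 0 = mapAux _ _ _ _ 0 + mapAux _ _ _ _ 0
      simp
    | ht x y => exact (congrArg (tmul · y) (add_smul r s x)).trans (add_tmul _ _ _)
    | ha z z' h h' =>
      change mapAux _ _ _ _ _ = mapAux _ _ _ _ _ + mapAux _ _ _ _ _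
      simp only [map_add]
      rw [add_add_add_comm]
      exact congrArg₂ (· + ·) h h'
  zero_smul z := by
    induction z using induction_on with
    | h0 => exact map_zero _
    | ht x y =>
      refine (congrArg (tmul · y) (zero_smul R x)).trans ?_
      exact map_zero ((tmulHom X Y).flip y)
    | ha z z' h h' => exact (map_add _ z z').trans ((congrArg₂ (· + ·) h h').trans (add_zero _))

/-- The right `R`-action on `X ⊗_R Y`. -/
instance : Module Rᵐᵒᵖ (Tensor X Y) where
  smul r z := mapAux (AddMonoidHom.id X) (DistribSMul.toAddMonoidHom Y r)
    (fun _ _ => rfl) (fun s x => by simpa using (smul_comm s r x).symm) z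
  one_smul z := by
    induction z using induction_on with
    | h0 => exact map_zero _
    | ht x y => exact congrArg (tmul x) (one_smul Rᵐᵒᵖ y)
    | ha z z' h h' => exact (map_add _ z z').trans (congrArg₂ (· + ·) h h')
  mul_smul r s z := by
    induction z using induction_on with
    | h0 =>
      change mapAux _ _ _ _ 0 = mapAux _ _ _ _ (mapAux _ _ _ _ 0)
      simp
    | ht x y => exact congrArg (tmul x) (mul_smul r s y)
    | ha z z' h h' =>
      change mapAux _ _ _ _ _ = mapAux _ _ _ _ (mapAux _ _ _ _ _)
      simp only [map_add]
      exact congrArg₂ (· + ·) h h'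
  smul_zero r := map_zero _
  smul_add r z z' := map_add _ z z'
  add_smul r s z := by
    induction z using induction_on with
    | h0 =>
      change mapAux _ _ _ _ 0 = mapAux _ _ _ _ 0 + mapAux _ _ _ _ 0
      simp
    | ht x y => exact (congrArg (tmul x) (add_smul r s y)).trans (tmul_add _ _ _)
    | ha z z' h h' =>
      change mapAux _ _ _ _ _ = mapAux _ _ _ _ _ + mapAux _ _ _ _ _
      simp only [map_add]
      rw [add_add_add_comm]
      exact congrArg₂ (· + ·) h h'
  zero_smul z := by
    induction z using induction_on with
    | h0 => exact map_zero _
    | ht x y => exact (congrArg (tmul x) (zero_smul Rᵐᵒᵖ y)).trans (map_zero (tmulHom X Y x))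
    | ha z z' h h' => exact (map_add _ z z').trans ((congrArg₂ (· + ·) h h').trans (add_zero _))

@[simp] theorem left_smul_tmul (r : R) (x : X) (y : Y) : r • tmul x y = tmul (r • x) y := rfl

@[simp] theorem right_smul_tmul (r : Rᵐᵒᵖ) (x : X) (y : Y) : r • tmul x y = tmul x (r • y) := rfl

instance : SMulCommClass R Rᵐᵒᵖ (Tensor X Y) where
  smul_comm r s z := by
    induction z using induction_on with
    | h0 => simp
    | ht x y => simp
    | ha z z' h h' => simp only [smul_add, h, h']

end Tensor

open Tensor

/-- The bimodule `X ⊗_R Y`. -/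
abbrev tensor (X Y : BimodCat R) : BimodCat R := ⟨Tensor X Y⟩

/-- The regular bimodule. -/
abbrev regular (R : Type u) [Ring R] : BimodCat R := ⟨R⟩

variable {X Y X' Y' Z Z' W : BimodCat R}

theorem tensor_hom_ext {f g : tensor X Y ⟶ Z} (h : ∀ x y, f (tmul x y) = g (tmul x y)) : f = g :=
  hom_ext fun z => DFunLike.congr_fun
    (addHom_ext (f := (f.toAddHom : Tensor X Y →+ Z)) (g := g.toAddHom) h) z

/-- A bimodule morphism out of `X ⊗_R Y`. -/
def tensorLift (f : X →+ Y →+ Z) (hf : ∀ x (r : R) y, f (op r • x) y = f x (r • y))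
    (h₁ : ∀ (r : R) x y, f (r • x) y = r • f x y)
    (h₂ : ∀ (r : R) x y, f x (op r • y) = op r • f x y) : tensor X Y ⟶ Z :=
  ofHom (Tensor.lift f hf)
    (fun r z => DFunLike.congr_fun (addHom_ext
      (f := (Tensor.lift f hf).comp (DistribSMul.toAddMonoidHom (Tensor X Y) r))
      (g := (DistribSMul.toAddMonoidHom Z r).comp (Tensor.lift f hf)) (by simp [h₁])) z)
    (fun r z => DFunLike.congr_fun (addHom_ext
      (f := (Tensor.lift f hf).comp (DistribSMul.toAddMonoidHom (Tensor X Y) (op r)))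
      (g := (DistribSMul.toAddMonoidHom Z (op r)).comp (Tensor.lift f hf)) (by simp [h₂])) z)

@[simp] theorem tensorLift_tmul (f : X →+ Y →+ Z) (hf h₁ h₂) (x : X) (y : Y) :
    tensorLift f hf h₁ h₂ (tmul x y) = f x y := rfl

/-- The tensor product of bimodule morphisms. -/
def tensorMap (f : X ⟶ X') (g : Y ⟶ Y') : tensor X Y ⟶ tensor X' Y' :=
  tensorLift (Z := tensor X' Y') (((tmulHom X' Y').compl₂ g.toAddHom).comp f.toAddHom)
    (fun x r y => by
      change tmul (f (op r • x)) (g y) = tmul (f x) (g (r • y))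
      rw [hom_smul, hom_op_smul, smul_tmul])
    (fun r x y => congrArg (tmul · (g y)) (hom_smul f r x))
    (fun r x y => congrArg (tmul (f x)) (hom_op_smul g r y))

@[simp] theorem tensorMap_tmul (f : X ⟶ X') (g : Y ⟶ Y') (x : X) (y : Y) :
    tensorMap f g (tmul x y) = tmul (f x) (g y) := rfl

/-- The additive map `x ⊗ y ↦ (z ↦ x ⊗ (y ⊗ z))`. -/
def assocAux (X Y Z : BimodCat R) : Tensor X Y →+ Z →+ tensor X (tensor Y Z) :=
  Tensor.lift
    (AddMonoidHom.mk' (fun x => AddMonoidHom.mk' (fun y =>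
      (tmulHom X (tensor Y Z) x).comp (tmulHom Y Z y)) (fun y y' => by ext z; simp))
      (fun x x' => by ext y z; simp))
    (fun x r y => by ext z; exact smul_tmul (Y := tensor Y Z) x r (tmul y z))

theorem assocAux_tmul (x : X) (y : Y) (z : Z) :
    assocAux X Y Z (tmul x y) z = tmul (Y := tensor Y Z) x (tmul y z) := rfl

/-- `(x ⊗ y) ⊗ z ↦ x ⊗ (y ⊗ z)`. -/
def assocHom (X Y Z : BimodCat R) : tensor (tensor X Y) Z ⟶ tensor X (tensor Y Z) :=
  tensorLift (X := tensor X Y) (Z := tensor X (tensor Y Z)) (assocAux X Y Z)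
    (fun z r w => by
      induction z using induction_on with
      | h0 => rw [smul_zero, map_zero]; rfl
      | ht x y =>
        exact congrArg (tmul (Y := tensor Y Z) x) (smul_tmul y r w)
      | ha z z' h h' =>
        rw [smul_add, map_add, map_add, AddMonoidHom.add_apply, AddMonoidHom.add_apply, h, h'])
    (fun r z w => by
      induction z using induction_on with
      | h0 => rw [smul_zero, map_zero]; exact (smul_zero r).symm
      | ht x y => rfl
      | ha z z' h h' =>
        rw [smul_add, map_add, map_add, AddMonoidHom.add_apply, AddMonoidHom.add_apply, h, h',
          smul_add])
    (fun r z w => by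
      induction z using induction_on with
      | h0 => rw [map_zero]; exact (smul_zero (op r)).symm
      | ht x y => rfl
      | ha z z' h h' =>
        rw [map_add, AddMonoidHom.add_apply, AddMonoidHom.add_apply, h, h', smul_add])

@[simp] theorem assocHom_tmul (x : X) (y : Y) (z : Z) :
    assocHom X Y Z (tmul (X := tensor X Y) (tmul x y) z) =
      tmul (Y := tensor Y Z) x (tmul y z) := rfl

/-- `x ⊗ (y ⊗ z) ↦ (x ⊗ y) ⊗ z`. -/
def assocInv (X Y Z : BimodCat R) : tensor X (tensor Y Z) ⟶ tensor (tensor X Y) Z :=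
  tensorLift (Y := tensor Y Z) (Z := tensor (tensor X Y) Z)
    (AddMonoidHom.mk' (fun x => Tensor.lift
      (AddMonoidHom.mk' (fun y => tmulHom (tensor X Y) Z (tmul x y))
        (fun y y' => by ext z; simp [tmul_add]))
      (fun y r z => by
        change tmul (X := tensor X Y) (tmul x (op r • y)) z =
          tmul (X := tensor X Y) (tmul x y) (r • z)
        rw [← smul_tmul]; rfl))
      (fun x x' => addHom_ext fun y z => by simp [add_tmul]))
    (fun x r w => by
      induction w using induction_on with
      | h0 => simp
      | ht y z => simp [smul_tmul]
      | ha z z' h h' => simp only [smul_add, map_add, h, h'])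
    (fun r x w => by
      induction w using induction_on with
      | h0 => simp
      | ht y z =>
        change tmul (X := tensor X Y) (tmul (r • x) y) z = r • tmul (X := tensor X Y) (tmul x y) z
        rfl
      | ha z z' h h' => simp only [smul_add, map_add, h, h'])
    (fun r x w => by
      induction w using induction_on with
      | h0 => simp
      | ht y z => rfl
      | ha z z' h h' => simp only [smul_add, map_add, h, h'])

@[simp] theorem assocInv_tmul (x : X) (y : Y) (z : Z) :
    assocInv X Y Z (tmul (Y := tensor Y Z) x (tmul y z)) =
      tmul (X := tensor X Y) (tmul x y) z := rfl

theorem tensor₃_hom_ext {f g : tensor (tensor X Y) Z ⟶ W}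
    (h : ∀ x y z, f (tmul (X := tensor X Y) (tmul x y) z) =
      g (tmul (X := tensor X Y) (tmul x y) z)) : f = g := by
  refine tensor_hom_ext fun w z => ?_
  induction w using induction_on with
  | h0 =>
    have : tmul (X := tensor X Y) 0 z = 0 := map_zero ((tmulHom (tensor X Y) Z).flip z)
    simp [this]
  | ht x y => exact h x y z
  | ha w w' h h' =>
    have : tmul (X := tensor X Y) (w + w') z =
      tmul (X := tensor X Y) w z + tmul (X := tensor X Y) w' z := add_tmul _ _ _
    rw [this, map_add, map_add, h, h']

theorem tensor₄_hom_ext {V : BimodCat R} {f g : tensor (tensor (tensor X Y) Z) W ⟶ V}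
    (h : ∀ x y z w,
      f (tmul (X := tensor (tensor X Y) Z) (tmul (X := tensor X Y) (tmul x y) z) w) =
      g (tmul (X := tensor (tensor X Y) Z) (tmul (X := tensor X Y) (tmul x y) z) w)) : f = g := by
  refine tensor₃_hom_ext fun v z w => ?_
  induction v using induction_on with
  | h0 =>
    have h₁ : tmul (X := tensor X Y) 0 z = 0 := map_zero ((tmulHom (tensor X Y) Z).flip z)
    have h₂ : tmul (X := tensor (tensor X Y) Z) 0 w = 0 :=
      map_zero ((tmulHom (tensor (tensor X Y) Z) W).flip w)
    rw [h₁, h₂, map_zero, map_zero]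
  | ht x y => exact h x y z w
  | ha v v' h h' =>
    have h₁ : tmul (X := tensor X Y) (v + v') z =
      tmul (X := tensor X Y) v z + tmul (X := tensor X Y) v' z := add_tmul _ _ _
    have h₂ : ∀ u u', tmul (X := tensor (tensor X Y) Z) (u + u') w =
      tmul (X := tensor (tensor X Y) Z) u w + tmul (X := tensor (tensor X Y) Z) u' w :=
        fun u u' => add_tmul _ _ _
    rw [h₁, h₂, map_add, map_add, h, h']

theorem tensor₃'_hom_ext {f g : tensor X (tensor Y Z) ⟶ W}
    (h : ∀ x y z, f (tmul (Y := tensor Y Z) x (tmul y z)) =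
      g (tmul (Y := tensor Y Z) x (tmul y z))) : f = g := by
  have : assocHom X Y Z ≫ f = assocHom X Y Z ≫ g := tensor₃_hom_ext h
  have h' : assocInv X Y Z ≫ assocHom X Y Z = 𝟙 _ := by
    refine tensor_hom_ext fun x w => ?_
    induction w using induction_on with
    | h0 =>
      have : tmul (Y := tensor Y Z) x 0 = 0 := map_zero (tmulHom X (tensor Y Z) x)
      simp [this]
    | ht y z => rfl
    | ha w w' h h' =>
      have : tmul (Y := tensor Y Z) x (w + w') =
        tmul (Y := tensor Y Z) x w + tmul (Y := tensor Y Z) x w' := tmul_add _ _ _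
      rw [this, map_add, map_add, h, h']
  rw [← Category.id_comp f, ← Category.id_comp g, ← h', Category.assoc, this, Category.assoc]

/-- The isomorphism `R ⊗_R X ≅ X`. -/
def leftUnitorIso (X : BimodCat R) : tensor (regular R) X ≅ X where
  hom := tensorLift (X := regular R)
    (AddMonoidHom.mk' (fun r => DistribSMul.toAddMonoidHom X (r : R))
      (fun r s => by ext x; exact add_smul (r : R) s x))
    (fun s r x => mul_smul (s : R) r x) (fun r s x => mul_smul (r : R) s x)
    (fun r s x => smul_comm (s : R) (op r) x)
  inv := ofHom (tmulHom (regular R) X (1 : R))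
    (fun r x => by
      change tmul (X := regular R) (1 : R) (r • x) = tmul (X := regular R) (r * 1 : R) x
      rw [← smul_tmul]
      change tmul (X := regular R) (1 * r : R) x = _
      simp)
    (fun r x => rfl)
  hom_inv_id := tensor_hom_ext fun r x => by
    change tmul (X := regular R) (1 : R) ((r : R) • x) = tmul r x
    rw [← smul_tmul]
    change tmul (X := regular R) (1 * r : R) x = _
    simp
  inv_hom_id := hom_ext fun x => one_smul R x

/-- The isomorphism `X ⊗_R R ≅ X`. -/
def rightUnitorIso (X : BimodCat R) : tensor X (regular R) ≅ X where
  hom := tensorLift (Y := regular R)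
    (AddMonoidHom.mk' (fun x => AddMonoidHom.mk' (fun r : R => op r • x)
      (fun r s => by exact add_smul (op r) (op s) x))
      (fun x y => by ext r; exact smul_add (op (r : R)) x y))
    (fun x s r => (mul_smul (op r : Rᵐᵒᵖ) (op s) x).symm)
    (fun r x s => (smul_comm r (op (s : R)) x).symm)
    (fun r x s => mul_smul (op r : Rᵐᵒᵖ) (op s) x)
  inv := ofHom ((tmulHom X (regular R)).flip (1 : R))
    (fun r x => rfl)
    (fun r x => by
      change tmul (Y := regular R) (op r • x) (1 : R) = tmul (Y := regular R) x (1 * r : R)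
      rw [smul_tmul]
      change tmul (Y := regular R) x (r * 1 : R) = _
      simp)
  hom_inv_id := tensor_hom_ext fun x r => by
    change tmul (Y := regular R) (op (r : R) • x) (1 : R) = tmul x r
    rw [smul_tmul]
    change tmul (Y := regular R) x (r * 1 : R) = _
    simp
  inv_hom_id := hom_ext fun x => one_smul Rᵐᵒᵖ x

/-- The monoidal category of `R`-`R`-bimodules. -/
instance : MonoidalCategoryStruct (BimodCat R) where
  tensorObj X Y := tensor X Y
  whiskerLeft X _ _ f := tensorMap (𝟙 X) f
  whiskerRight f X := tensorMap f (𝟙 X)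
  tensorHom f g := tensorMap f g
  tensorUnit := regular R
  associator X Y Z := ⟨assocHom X Y Z, assocInv X Y Z,
    tensor₃_hom_ext fun _ _ _ => rfl, tensor₃'_hom_ext fun _ _ _ => rfl⟩
  leftUnitor X := leftUnitorIso X
  rightUnitor X := rightUnitorIso X

instance : MonoidalCategory (BimodCat R) :=
  MonoidalCategory.ofTensorHom
    (id_tensorHom_id := fun _ _ => tensor_hom_ext fun _ _ => rfl)
    (id_tensorHom := fun _ _ _ _ => rfl)
    (tensorHom_id := fun _ _ => rfl)
    (tensorHom_comp_tensorHom := fun _ _ _ _ => tensor_hom_ext fun _ _ => rfl)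
    (associator_naturality := fun _ _ _ => tensor₃_hom_ext fun _ _ _ => rfl)
    (leftUnitor_naturality := fun f => tensor_hom_ext fun r x => (hom_smul f (r : R) x).symm)
    (rightUnitor_naturality := fun f => tensor_hom_ext fun x r =>
      (hom_op_smul f (r : R) x).symm)
    (pentagon := fun _ _ _ _ => tensor₄_hom_ext fun _ _ _ _ => rfl)
    (triangle := fun _ _ => tensor₃_hom_ext (Y := regular R) fun x r y =>
      (smul_tmul x (r : R) y).symm)

end BimodCat

/-! ### Bialgebroids -/

/-- Ring homomorphisms `s : R → A` and `t : Rᵒᵖ → A` with commuting images. -/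
@[ext]
structure SourceTarget (R A : Type u) [Ring R] [Ring A] where
  source : R →+* A
  target : Rᵐᵒᵖ →+* A
  commute : ∀ r r', Commute (source r) (target r')

namespace SourceTarget

open MulOpposite BimodCat BimodCat.Tensor

variable {R A : Type u} [Ring R] [Ring A] (S : SourceTarget R A)

/-- The ring homomorphism `R → Aᵒᵖ` corresponding to `t`. -/
def targetOp : R →+* Aᵐᵒᵖ where
  toFun r := op (S.target (op r))
  map_one' := by simp
  map_zero' := by simp
  map_mul' r r' := by simp
  map_add' r r' := by simp

/-- The forgetful functor from right `A`-modules to `R`-`R`-bimodules, with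
`r · v = v t(r)` and `v · r = v s(r)`. Right `A`-modules are modules over `Aᵐᵒᵖ`. -/
def restrict : ModuleCat.{u} Aᵐᵒᵖ ⥤ BimodCat R where
  obj V :=
    letI : Module R V := Module.compHom V S.targetOp
    letI : Module Rᵐᵒᵖ V := Module.compHom V (RingHom.op S.source)
    { carrier := V
      smulComm := ⟨fun r r' v => by
        change op (S.target (op r)) • op (S.source (unop r')) • v =
          op (S.source (unop r')) • op (S.target (op r)) • v
        rw [← mul_smul, ← mul_smul, ← op_mul, ← op_mul, (S.commute _ _).eq]⟩ }
  map f := ofHom f.hom.toAddMonoidHom (fun r v => f.hom.map_smul (op (S.target (op r))) v)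
    (fun r v => f.hom.map_smul (op (S.source r)) v)

instance : S.restrict.Faithful where
  map_injective {_ _} _ _ h := by
    ext v
    exact DFunLike.congr_fun h v

/-- The ring `A` as an `R`-`R`-bimodule. -/
abbrev bimodule : BimodCat R := S.restrict.obj (ModuleCat.of Aᵐᵒᵖ A)

/-- The morphism of bimodules `A → V`, `x ↦ v x`. For `V = A` this is a left multiplication. -/
def orbit {V : ModuleCat.{u} Aᵐᵒᵖ} (v : V) : S.bimodule ⟶ S.restrict.obj V :=
  S.restrict.map (ModuleCat.ofHom
    { toFun := fun x : A => op x • v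
      map_add' := fun x y => add_smul (op x) (op y) v
      map_smul' := fun x y => by
        change op (y * unop x) • v = x • op y • v
        rw [op_mul, op_unop, mul_smul] })

theorem orbit_apply {V : ModuleCat.{u} Aᵐᵒᵖ} (v : V) (x : A) : S.orbit v x = op x • v := rfl

/-- Left multiplication `A → A`, `x ↦ a x`, as a morphism of bimodules. -/
abbrev leftMul (a : A) : S.bimodule ⟶ S.bimodule := S.orbit (V := ModuleCat.of Aᵐᵒᵖ A) a

theorem leftMul_apply (a x : A) : S.leftMul a x = a * x := rfl

/-- The elements `z` of `A ⊗_R A` with `(s(r) ⊗ 1) z = (1 ⊗ t(r)) z` for all `r`. -/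
def takeuchi : AddSubgroup (Tensor S.bimodule S.bimodule) where
  carrier := {z | ∀ r : R, tensorMap (S.leftMul (S.source r)) (𝟙 _) z =
    tensorMap (𝟙 _) (S.leftMul (S.target (op r))) z}
  zero_mem' _ := (map_zero _).trans (map_zero _).symm
  add_mem' {z z'} h h' r :=
    (map_add _ z z').trans ((congrArg₂ (· + ·) (h r) (h' r)).trans (map_add _ z z').symm)
  neg_mem' {z} h r := (map_neg _ z).trans ((congrArg (- ·) (h r)).trans (map_neg _ z).symm)

theorem orbit_hom {V V' : ModuleCat.{u} Aᵐᵒᵖ} (f : V ⟶ V') (v : V) :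
    S.orbit (f.hom v) = S.orbit v ≫ S.restrict.map f :=
  hom_ext fun x => (f.hom.map_smul (op (show A from x)) v).symm

theorem orbit_source {V : ModuleCat.{u} Aᵐᵒᵖ} (v : V) (r : R) :
    S.orbit (op (S.source r) • v) = S.leftMul (S.source r) ≫ S.orbit v :=
  hom_ext fun x => (mul_smul (op (show A from x)) (op (S.source r)) v).symm

theorem orbit_target {V : ModuleCat.{u} Aᵐᵒᵖ} (v : V) (r : R) :
    S.orbit (op (S.target (op r)) • v) = S.leftMul (S.target (op r)) ≫ S.orbit v :=
  hom_ext fun x => (mul_smul (op (show A from x)) (op (S.target (op r))) v).symm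

theorem tensorMap_orbit_add_left {V : ModuleCat.{u} Aᵐᵒᵖ} {X : BimodCat R} (v v' : V)
    (g : S.bimodule ⟶ X) (z : Tensor S.bimodule S.bimodule) :
    tensorMap (S.orbit (v + v')) g z =
      tensorMap (S.orbit v) g z + tensorMap (S.orbit v') g z :=
  DFunLike.congr_fun (addHom_ext
    (f := (tensorMap (S.orbit (v + v')) g).toAddHom)
    (g := (tensorMap (S.orbit v) g).toAddHom + (tensorMap (S.orbit v') g).toAddHom)
    fun x y => (congrArg (tmul · (g y)) (smul_add (op (show A from x)) v v')).trans
      (add_tmul (S.orbit v x) (S.orbit v' x) (g y))) z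

theorem tensorMap_orbit_add_right {V : ModuleCat.{u} Aᵐᵒᵖ} {X : BimodCat R} (v v' : V)
    (f : S.bimodule ⟶ X) (z : Tensor S.bimodule S.bimodule) :
    tensorMap f (S.orbit (v + v')) z =
      tensorMap f (S.orbit v) z + tensorMap f (S.orbit v') z :=
  DFunLike.congr_fun (addHom_ext
    (f := (tensorMap f (S.orbit (v + v'))).toAddHom)
    (g := (tensorMap f (S.orbit v)).toAddHom + (tensorMap f (S.orbit v')).toAddHom)
    fun x y => (congrArg (tmul (f x)) (smul_add (op (show A from y)) v v')).trans
      (tmul_add (f x) (S.orbit v y) (S.orbit v' y))) z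

theorem tensorMap_comp_apply {X Y X' Y' X'' Y'' : BimodCat R} (f : X ⟶ X') (g : Y ⟶ Y')
    (f' : X' ⟶ X'') (g' : Y' ⟶ Y'') (z : Tensor X Y) :
    tensorMap f' g' (tensorMap f g z) = tensorMap (f ≫ f') (g ≫ g') z :=
  DFunLike.congr_fun (show tensorMap f g ≫ tensorMap f' g' = tensorMap (f ≫ f') (g ≫ g') from
    tensor_hom_ext fun _ _ => rfl) z

variable {S} in
/-- The right multiplication of `V ⊗_R W` by an element `z = ∑ zᵢ ⊗ zᵢ'` of `S.takeuchi`,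
`(v ⊗ w) z = ∑ v zᵢ ⊗ w zᵢ'`. -/
def act (V W : ModuleCat.{u} Aᵐᵒᵖ) (z : S.takeuchi) :
    Tensor (S.restrict.obj V) (S.restrict.obj W) →+
      Tensor (S.restrict.obj V) (S.restrict.obj W) :=
  Tensor.lift
    (AddMonoidHom.mk' (fun v => AddMonoidHom.mk' (fun w =>
        tensorMap (S.orbit (V := V) v) (S.orbit (V := W) w) z.1)
      (fun w w' => S.tensorMap_orbit_add_right (V := W) w w' _ z.1))
      (fun v v' => AddMonoidHom.ext fun w =>
        S.tensorMap_orbit_add_left (V := V) v v' (S.orbit (V := W) w) z.1))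
    (fun v r w => by
      change tensorMap (S.orbit (op (S.source r) • (show V from v))) (S.orbit (V := W) w) z.1 =
        tensorMap (S.orbit (V := V) v) (S.orbit (op (S.target (op r)) • (show W from w))) z.1
      rw [orbit_source, orbit_target, ← Category.id_comp (S.orbit (V := W) w),
        ← tensorMap_comp_apply, z.2 r, tensorMap_comp_apply]
      simp)

theorem act_tmul (V W : ModuleCat.{u} Aᵐᵒᵖ) (z : S.takeuchi) (v : V) (w : W) :
    act V W z (tmul v w) = tensorMap (S.orbit v) (S.orbit w) z.1 := rfl

/-- `act` is natural. -/
theorem act_naturality {V W V' W' : ModuleCat.{u} Aᵐᵒᵖ} (f : V ⟶ V') (g : W ⟶ W')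
    (z : S.takeuchi) (u : Tensor (S.restrict.obj V) (S.restrict.obj W)) :
    act V' W' z (tensorMap (S.restrict.map f) (S.restrict.map g) u) =
      tensorMap (S.restrict.map f) (S.restrict.map g) (act V W z u) := by
  induction u using Tensor.induction_on with
  | h0 => simp only [map_zero]
  | ht v w =>
    change tensorMap (S.orbit (f.hom (show V from v))) (S.orbit (g.hom (show W from w))) z.1 =
      tensorMap (S.restrict.map f) (S.restrict.map g)
        (tensorMap (S.orbit (V := V) v) (S.orbit (V := W) w) z.1)
    rw [orbit_hom, orbit_hom, tensorMap_comp_apply]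
  | ha u u' h h' => simp only [map_add, h, h']

end SourceTarget

open BimodCat.Tensor in
open scoped MonoidalCategory in
/-- A bialgebroid structure over `R` on the ring `A`: ring homomorphisms `s : R → A` and
`t : Rᵒᵖ → A` with commuting images, and a comonoid structure `(γ, π)` in `R`-`R`-bimodules on
`A` (with `r · a = a t(r)`, `a · r = a s(r)`), such that
`(s(r) ⊗ 1) γ(a) = (1 ⊗ t(r)) γ(a)`, `γ(ab) = γ(a) γ(b)`, `γ(1) = 1 ⊗ 1`, `π(1) = 1`, and
`π(t(π(a)) b) = π(ab) = π(s(π(a)) b)`. -/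
@[ext]
structure Bialgebroid (R A : Type u) [Ring R] [Ring A] extends SourceTarget R A where
  /-- The comultiplication `γ`. -/
  comul : toSourceTarget.bimodule ⟶ toSourceTarget.bimodule ⊗ toSourceTarget.bimodule
  /-- The counit `π`. -/
  counit : toSourceTarget.bimodule ⟶ 𝟙_ (BimodCat R)
  coassoc : comul ≫ comul ▷ toSourceTarget.bimodule ≫
    (α_ toSourceTarget.bimodule toSourceTarget.bimodule toSourceTarget.bimodule).hom =
      comul ≫ toSourceTarget.bimodule ◁ comul
  counit_left : comul ≫ counit ▷ toSourceTarget.bimodule ≫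
    (λ_ toSourceTarget.bimodule).hom = 𝟙 toSourceTarget.bimodule
  counit_right : comul ≫ toSourceTarget.bimodule ◁ counit ≫
    (ρ_ toSourceTarget.bimodule).hom = 𝟙 toSourceTarget.bimodule
  comul_mem : ∀ a : A, comul a ∈ toSourceTarget.takeuchi
  comul_mul : ∀ a b : A, comul (a * b : A) =
    SourceTarget.act _ _ ⟨comul b, comul_mem b⟩ (comul a)
  comul_one : comul (1 : A) = tmul (X := toSourceTarget.bimodule) (Y := toSourceTarget.bimodule)
    (1 : A) (1 : A)
  counit_one : counit (1 : A) = (1 : R)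
  counit_target_mul : ∀ a b : A, counit (target (MulOpposite.op (counit a)) * b : A) =
    counit (a * b : A)
  counit_source_mul : ∀ a b : A, counit (source (counit a) * b : A) = counit (a * b : A)

section

set_option linter.unusedSimpArgs false

open MonoidalCategory

variable {C : Type*} [Category C] [MonoidalCategory C] {X U V W P P' Q Q' : C}

theorem Bialgebroid.coassoc_tensorHom (γ : X ⟶ X ⊗ X)
    (h : γ ≫ γ ▷ X ≫ (α_ X X X).hom = γ ≫ X ◁ γ) (p : X ⟶ U) (q : X ⟶ V) (r : X ⟶ W)
    (m : U ⊗ V ≅ P) (m' : P ⊗ W ≅ P') (n : V ⊗ W ≅ Q) (n' : U ⊗ Q ≅ Q') :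
    (γ ≫ ((γ ≫ (p ⊗ₘ q) ≫ m.hom) ⊗ₘ r) ≫ m'.hom) ≫
      ((m'.symm ≪≫ (m.symm ⊗ᵢ .refl _)) ≪≫ α_ U V W ≪≫ (.refl _ ⊗ᵢ n) ≪≫ n').hom =
      γ ≫ (p ⊗ₘ (γ ≫ (q ⊗ₘ r) ≫ n.hom)) ≫ n'.hom := by
  have h₁ : (γ ≫ (p ⊗ₘ q) ≫ m.hom) ⊗ₘ r = γ ▷ X ≫ ((p ⊗ₘ q) ⊗ₘ r) ≫ m.hom ▷ W := by
    simp only [← id_tensorHom, ← tensorHom_id, tensorHom_comp_tensorHom, Category.id_comp,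
      Category.comp_id, Category.assoc]
  have h₂ : p ⊗ₘ (γ ≫ (q ⊗ₘ r) ≫ n.hom) = X ◁ γ ≫ (p ⊗ₘ (q ⊗ₘ r)) ≫ U ◁ n.hom := by
    simp only [← id_tensorHom, ← tensorHom_id, tensorHom_comp_tensorHom, Category.id_comp,
      Category.comp_id, Category.assoc]
  rw [h₁, h₂]
  simp only [Iso.trans_hom, Iso.symm_hom, tensorIso_hom, Iso.refl_hom, Category.assoc,
    Iso.hom_inv_id_assoc, tensorHom_id, id_tensorHom, hom_inv_whiskerRight_assoc,
    associator_naturality_assoc]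
  rw [← reassoc_of% h]

theorem Bialgebroid.counit_left_tensorHom (γ : X ⟶ X ⊗ X) (π : X ⟶ 𝟙_ C)
    (h : γ ≫ π ▷ X ≫ (λ_ X).hom = 𝟙 X) (s t : X ⟶ X) (hst : γ ≫ (s ⊗ₘ 𝟙 X) = γ ≫ (𝟙 X ⊗ₘ t))
    (v : X ⟶ V) (e : 𝟙_ C ≅ Q) (m : Q ⊗ V ≅ P) :
    (γ ≫ ((s ≫ π ≫ e.hom) ⊗ₘ v) ≫ m.hom) ≫
      ((m.symm ≪≫ (e.symm ⊗ᵢ .refl _)) ≪≫ λ_ V).hom = t ≫ v := by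
  have h₁ : (s ≫ π ≫ e.hom) ⊗ₘ v = (s ⊗ₘ 𝟙 X) ≫ (π ⊗ₘ v) ≫ e.hom ▷ V := by
    simp only [← id_tensorHom, ← tensorHom_id, tensorHom_comp_tensorHom, Category.id_comp,
      Category.comp_id, Category.assoc]
  rw [h₁]
  simp only [Category.assoc]
  rw [reassoc_of% hst]
  have h₂ : (𝟙 X ⊗ₘ t) ≫ (π ⊗ₘ v) = π ▷ X ≫ _ ◁ (t ≫ v) := by
    simp only [← id_tensorHom, ← tensorHom_id, tensorHom_comp_tensorHom, Category.id_comp,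
      Category.comp_id, Category.assoc]
  simp only [Iso.trans_hom, Iso.symm_hom, tensorIso_hom, Iso.refl_hom, Category.assoc,
    Iso.hom_inv_id_assoc, tensorHom_id, id_tensorHom, hom_inv_whiskerRight_assoc] at h₂ ⊢
  rw [reassoc_of% h₂, leftUnitor_naturality, reassoc_of% h]

theorem Bialgebroid.counit_right_tensorHom (γ : X ⟶ X ⊗ X) (π : X ⟶ 𝟙_ C)
    (h : γ ≫ X ◁ π ≫ (ρ_ X).hom = 𝟙 X) (s t : X ⟶ X) (hst : γ ≫ (s ⊗ₘ 𝟙 X) = γ ≫ (𝟙 X ⊗ₘ t))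
    (v : X ⟶ V) (e : 𝟙_ C ≅ Q) (m : V ⊗ Q ≅ P) :
    (γ ≫ (v ⊗ₘ (t ≫ π ≫ e.hom)) ≫ m.hom) ≫
      ((m.symm ≪≫ (.refl _ ⊗ᵢ e.symm)) ≪≫ ρ_ V).hom = s ≫ v := by
  have h₁ : v ⊗ₘ (t ≫ π ≫ e.hom) = (𝟙 X ⊗ₘ t) ≫ (v ⊗ₘ π) ≫ V ◁ e.hom := by
    simp only [← id_tensorHom, ← tensorHom_id, tensorHom_comp_tensorHom, Category.id_comp,
      Category.comp_id, Category.assoc]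
  rw [h₁]
  simp only [Category.assoc]
  rw [← reassoc_of% hst]
  have h₂ : (s ⊗ₘ 𝟙 X) ≫ (v ⊗ₘ π) = X ◁ π ≫ (s ≫ v) ▷ _ := by
    simp only [← id_tensorHom, ← tensorHom_id, tensorHom_comp_tensorHom, Category.id_comp,
      Category.comp_id, Category.assoc]
  simp only [Iso.trans_hom, Iso.symm_hom, tensorIso_hom, Iso.refl_hom, Category.assoc,
    Iso.hom_inv_id_assoc, tensorHom_id, id_tensorHom, whiskerLeft_hom_inv_assoc] at h₂ ⊢
  rw [reassoc_of% h₂, rightUnitor_naturality, reassoc_of% h]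

end

namespace Bialgebroid

open MulOpposite BimodCat BimodCat.Tensor MonoidalCategory

variable {R A : Type u} [Ring R] [Ring A] (B : Bialgebroid R A)

/-- The element `γ(a)` of `B.takeuchi`. -/
def comulT (a : A) : B.takeuchi := ⟨B.comul a, B.comul_mem a⟩

theorem act_comul_mul (V W : ModuleCat.{u} Aᵐᵒᵖ) (a b : A)
    (z : Tensor (B.restrict.obj V) (B.restrict.obj W)) :
    SourceTarget.act V W (B.comulT (a * b)) z =
      SourceTarget.act V W (B.comulT b) (SourceTarget.act V W (B.comulT a) z) := by
  induction z using Tensor.induction_on with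
  | h0 => simp only [map_zero]
  | ht v w =>
    change tensorMap (B.orbit (V := V) v) (B.orbit (V := W) w) (B.comul (a * b : A)) =
      SourceTarget.act V W (B.comulT b)
        (tensorMap (B.orbit (V := V) v) (B.orbit (V := W) w) (B.comul a))
    rw [comul_mul]
    exact (B.act_naturality _ _ (B.comulT b) (B.comul a)).symm
  | ha u u' h h' => simp only [map_add, h, h']

theorem act_comul_one (V W : ModuleCat.{u} Aᵐᵒᵖ)
    (z : Tensor (B.restrict.obj V) (B.restrict.obj W)) :
    SourceTarget.act V W (B.comulT 1) z = z := by
  induction z using Tensor.induction_on with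
  | h0 => simp only [map_zero]
  | ht v w =>
    change tensorMap (B.orbit (V := V) v) (B.orbit (V := W) w) (B.comul (1 : A)) = _
    rw [comul_one]
    exact congrArg₂ tmul (one_smul Aᵐᵒᵖ (show V from v)) (one_smul Aᵐᵒᵖ (show W from w))
  | ha u u' h h' => simp only [map_add, h, h']

theorem act_comul_add (V W : ModuleCat.{u} Aᵐᵒᵖ) (a b : A)
    (z : Tensor (B.restrict.obj V) (B.restrict.obj W)) :
    SourceTarget.act V W (B.comulT (a + b)) z =
      SourceTarget.act V W (B.comulT a) z + SourceTarget.act V W (B.comulT b) z := by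
  induction z using Tensor.induction_on with
  | h0 => simp only [map_zero, add_zero]
  | ht v w =>
    change tensorMap (B.orbit (V := V) v) (B.orbit (V := W) w) (B.comul (a + b : A)) =
      tensorMap (B.orbit (V := V) v) (B.orbit (V := W) w) (B.comul a) +
      tensorMap (B.orbit (V := V) v) (B.orbit (V := W) w) (B.comul b)
    exact (congrArg _ (map_add B.comul a b)).trans (map_add _ _ _)
  | ha u u' h h' => simp only [map_add, h, h', add_add_add_comm]

/-- The right `A`-action on `V ⊗_R W`, `(v ⊗ w) a = v a₁ ⊗ w a₂`. -/
@[reducible]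
def tensorModule (V W : ModuleCat.{u} Aᵐᵒᵖ) :
    Module Aᵐᵒᵖ (Tensor (B.restrict.obj V) (B.restrict.obj W)) where
  smul a z := SourceTarget.act V W (B.comulT a.unop) z
  one_smul z := B.act_comul_one V W z
  mul_smul a b z := B.act_comul_mul V W b.unop a.unop z
  smul_zero _ := map_zero _
  smul_add _ z z' := map_add _ z z'
  add_smul a b z := B.act_comul_add V W a.unop b.unop z
  zero_smul z := by
    have h := B.act_comul_add V W 0 0 z
    rw [add_zero] at h
    exact left_eq_add.1 h

theorem counit_mul_source (a : A) (r : R) :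
    B.counit (a * B.source r : A) = (B.counit a * r : R) :=
  hom_op_smul B.counit r a

theorem counit_mul_target (a : A) (r : R) :
    B.counit (a * B.target (op r) : A) = (r * B.counit a : R) :=
  hom_smul B.counit r a

theorem counit_source (r : R) : B.counit (B.source r) = r := by
  have h := B.counit_mul_source 1 r
  rw [one_mul, counit_one] at h
  exact h.trans (one_mul r)

/-- The right `A`-module `R`, with `r a = π(s(r) a)`. -/
@[reducible]
def unitModule : Module Aᵐᵒᵖ R where
  smul a r := B.counit (B.source r * a.unop : A)
  one_smul r := (congrArg B.counit (mul_one (B.source r))).trans (B.counit_source r)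
  mul_smul a b r := by
    change B.counit (B.source r * (b.unop * a.unop) : A) =
      B.counit (B.source (B.counit (B.source r * b.unop : A)) * a.unop : A)
    rw [counit_source_mul, mul_assoc]
  smul_zero a := by
    change B.counit (B.source 0 * a.unop : A) = 0
    rw [map_zero, zero_mul]
    exact map_zero B.counit
  smul_add a r r' := by
    change B.counit (B.source (r + r') * a.unop : A) = _
    rw [map_add, add_mul]
    exact map_add B.counit _ _
  add_smul a b r := by
    change B.counit (B.source r * (a.unop + b.unop) : A) = _
    rw [mul_add]
    exact map_add B.counit _ _
  zero_smul r := by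
    change B.counit (B.source r * 0 : A) = 0
    rw [mul_zero]
    exact map_zero B.counit

/-- The right `A`-module `V ⊗_R W`. -/
def tensorObj (V W : ModuleCat.{u} Aᵐᵒᵖ) : ModuleCat.{u} Aᵐᵒᵖ :=
  letI := B.tensorModule V W
  ModuleCat.of Aᵐᵒᵖ (Tensor (B.restrict.obj V) (B.restrict.obj W))

/-- The right `A`-module `R`. -/
def tensorUnit : ModuleCat.{u} Aᵐᵒᵖ :=
  letI := B.unitModule
  ModuleCat.of Aᵐᵒᵖ R

variable {B} in
/-- A morphism of right `A`-modules from an `A`-linear morphism of bimodules. -/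
def homOf {V W : ModuleCat.{u} Aᵐᵒᵖ} (f : B.restrict.obj V ⟶ B.restrict.obj W)
    (hf : ∀ v : V, B.orbit v ≫ f = B.orbit (V := W) (f v)) : V ⟶ W :=
  ModuleCat.ofHom
    { toFun := f
      map_add' := map_add f
      map_smul' := fun a v => DFunLike.congr_fun (hf v) a.unop }

variable {B} in
/-- An isomorphism of right `A`-modules from an `A`-linear isomorphism of bimodules. -/
def isoOf {V W : ModuleCat.{u} Aᵐᵒᵖ} (e : B.restrict.obj V ≅ B.restrict.obj W)
    (he : ∀ v : V, B.orbit v ≫ e.hom = B.orbit (V := W) (e.hom v)) : V ≅ W where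
  hom := homOf e.hom he
  inv := homOf e.inv fun w => by
    have h : e.hom (e.inv w) = w := DFunLike.congr_fun e.inv_hom_id w
    rw [Iso.comp_inv_eq, he (e.inv w), h]
  hom_inv_id := B.restrict.map_injective e.hom_inv_id
  inv_hom_id := B.restrict.map_injective e.inv_hom_id

theorem comul_target (r : R) : B.comul (B.target (op r)) =
    tmul (X := B.bimodule) (Y := B.bimodule) (B.target (op r)) (1 : A) := by
  have h := hom_smul B.comul r (1 : A)
  rw [comul_one] at h
  exact (congrArg B.comul (one_mul (B.target (op r))).symm).trans
    (h.trans (congrArg (tmul · _) (one_mul (B.target (op r)))))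

theorem comul_source (r : R) : B.comul (B.source r) =
    tmul (X := B.bimodule) (Y := B.bimodule) (1 : A) (B.source r) := by
  have h := hom_op_smul B.comul r (1 : A)
  rw [comul_one] at h
  exact (congrArg B.comul (one_mul (B.source r)).symm).trans
    (h.trans (congrArg (tmul _) (one_mul (B.source r))))

theorem act_target (V W : ModuleCat.{u} Aᵐᵒᵖ) (r : R)
    (z : Tensor (B.restrict.obj V) (B.restrict.obj W)) :
    SourceTarget.act V W (B.comulT (B.target (op r))) z = r • z := by
  induction z using Tensor.induction_on with
  | h0 => simp only [map_zero, smul_zero]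
  | ht v w =>
    change tensorMap (B.orbit (V := V) v) (B.orbit (V := W) w) (B.comul (B.target (op r))) = _
    rw [comul_target]
    exact congrArg (tmul _) (one_smul Aᵐᵒᵖ (show W from w))
  | ha u u' h h' => simp only [map_add, h, h', smul_add]

theorem act_source (V W : ModuleCat.{u} Aᵐᵒᵖ) (r : R)
    (z : Tensor (B.restrict.obj V) (B.restrict.obj W)) :
    SourceTarget.act V W (B.comulT (B.source r)) z = op r • z := by
  induction z using Tensor.induction_on with
  | h0 => simp only [map_zero, smul_zero]
  | ht v w =>
    change tensorMap (B.orbit (V := V) v) (B.orbit (V := W) w) (B.comul (B.source r)) = _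
    rw [comul_source]
    exact congrArg (tmul · _) (one_smul Aᵐᵒᵖ (show V from v))
  | ha u u' h h' => simp only [map_add, h, h', smul_add]

/-- The identity map `φ(V) ⊗ φ(W) ≅ φ(V ⊗ W)`. -/
def muIso (V W : ModuleCat.{u} Aᵐᵒᵖ) :
    B.restrict.obj V ⊗ B.restrict.obj W ≅ B.restrict.obj (B.tensorObj V W) where
  hom := ofHom (AddMonoidHom.id (Tensor (B.restrict.obj V) (B.restrict.obj W)))
    (fun r z => (B.act_target V W r z).symm) (fun r z => (B.act_source V W r z).symm)
  inv := ofHom (AddMonoidHom.id (Tensor (B.restrict.obj V) (B.restrict.obj W)))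
    (fun r z => B.act_target V W r z) (fun r z => B.act_source V W r z)
  hom_inv_id := rfl
  inv_hom_id := rfl

theorem counit_source_mul_target (x r : R) :
    B.counit (B.source x * B.target (op r) : A) = (r * x : R) :=
  (B.counit_mul_target _ r).trans (congrArg (r * ·) (B.counit_source x))

theorem counit_source_mul_source (x r : R) :
    B.counit (B.source x * B.source r : A) = (x * r : R) :=
  (B.counit_mul_source _ r).trans (congrArg (· * r) (B.counit_source x))

/-- The identity map `R ≅ φ(R)`. -/
def epsIso : 𝟙_ (BimodCat R) ≅ B.restrict.obj B.tensorUnit where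
  hom := ofHom (AddMonoidHom.id R)
    (fun r x => (B.counit_source_mul_target x r).symm)
    (fun r x => (B.counit_source_mul_source x r).symm)
  inv := ofHom (AddMonoidHom.id R)
    (fun r x => B.counit_source_mul_target x r)
    (fun r x => B.counit_source_mul_source x r)
  hom_inv_id := rfl
  inv_hom_id := rfl

/-- Tensor products of `A`-linear maps are `A`-linear. -/
theorem tensorMap_linear {V V' W W' : ModuleCat.{u} Aᵐᵒᵖ} (f : V ⟶ V') (g : W ⟶ W')
    (z : B.tensorObj V W) :
    B.orbit z ≫ (B.muIso V W).inv ≫ (B.restrict.map f ⊗ₘ B.restrict.map g) ≫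
      (B.muIso V' W').hom = B.orbit (V := B.tensorObj V' W')
        (tensorMap (B.restrict.map f) (B.restrict.map g) z) :=
  hom_ext fun a => (B.act_naturality f g (B.comulT a) z).symm

theorem orbit_tmul (V W : ModuleCat.{u} Aᵐᵒᵖ) (v : V) (w : W) :
    B.orbit (V := B.tensorObj V W)
      (tmul (X := B.restrict.obj V) (Y := B.restrict.obj W) v w) =
      B.comul ≫ (B.orbit v ⊗ₘ B.orbit w) ≫ (B.muIso V W).hom :=
  rfl

theorem linear_zero {U V : ModuleCat.{u} Aᵐᵒᵖ} (f : B.restrict.obj U ⟶ B.restrict.obj V) :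
    B.orbit (0 : U) ≫ f = B.orbit (V := V) (f (0 : U)) := by
  refine hom_ext fun a => ?_
  have h : f (0 : U) = (0 : V) := map_zero f
  rw [h]
  have h₁ : B.orbit (0 : U) a = (0 : U) := smul_zero (A := U) (op (show A from a))
  have h₂ : B.orbit (0 : V) a = (0 : V) := smul_zero (A := V) (op (show A from a))
  exact (congrArg f h₁).trans (h.trans h₂.symm)

theorem linear_add {U V : ModuleCat.{u} Aᵐᵒᵖ} (f : B.restrict.obj U ⟶ B.restrict.obj V)
    (z z' : U) (hz : B.orbit z ≫ f = B.orbit (V := V) (f z))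
    (hz' : B.orbit z' ≫ f = B.orbit (V := V) (f z')) :
    B.orbit (z + z') ≫ f = B.orbit (V := V) (f (z + z' : U)) := by
  refine hom_ext fun a => ?_
  have h : f (z + z' : U) = (show V from f z) + (show V from f z') := map_add f z z'
  rw [h]
  have h₁ : B.orbit (z + z' : U) a = B.orbit z a + B.orbit z' a :=
    smul_add (A := U) (op (show A from a)) z z'
  have h₂ : B.orbit ((show V from f z) + (show V from f z')) a =
      B.orbit (V := V) (f z) a + B.orbit (V := V) (f z') a :=
    smul_add (A := V) (op (show A from a)) _ _
  exact (congrArg f h₁).trans ((map_add f _ _).trans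
    ((congrArg₂ (· + ·) (DFunLike.congr_fun hz a) (DFunLike.congr_fun hz' a)).trans h₂.symm))

theorem linear_of_tmul {V W V' : ModuleCat.{u} Aᵐᵒᵖ}
    (f : B.restrict.obj (B.tensorObj V W) ⟶ B.restrict.obj V')
    (h : ∀ (v : V) (w : W),
      B.orbit (V := B.tensorObj V W)
        (tmul (X := B.restrict.obj V) (Y := B.restrict.obj W) v w) ≫ f =
      B.orbit (V := V') (f (tmul (X := B.restrict.obj V) (Y := B.restrict.obj W) v w)))
    (z : B.tensorObj V W) : B.orbit z ≫ f = B.orbit (V := V') (f z) :=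
  Tensor.induction_on (X := B.restrict.obj V) (Y := B.restrict.obj W)
    (p := fun z => B.orbit (V := B.tensorObj V W) z ≫ f = B.orbit (V := V') (f z)) z
    (B.linear_zero f) h (fun z z' h h' => B.linear_add f z z' h h')

theorem assoc_linear (U V W : ModuleCat.{u} Aᵐᵒᵖ)
    (z : B.tensorObj (B.tensorObj U V) W) :
    let f : B.restrict.obj (B.tensorObj (B.tensorObj U V) W) ≅
        B.restrict.obj (B.tensorObj U (B.tensorObj V W)) :=
      (((B.muIso _ _).symm ≪≫ ((B.muIso _ _).symm ⊗ᵢ .refl _))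
        ≪≫ α_ (B.restrict.obj U) (B.restrict.obj V) (B.restrict.obj W)
        ≪≫ ((.refl _ ⊗ᵢ B.muIso _ _) ≪≫ B.muIso _ _))
    B.orbit z ≫ f.hom = B.orbit (V := B.tensorObj U (B.tensorObj V W)) (f.hom z) := by
  intro f
  refine B.linear_of_tmul f.hom (fun y w => ?_) z
  refine Tensor.induction_on (X := B.restrict.obj U) (Y := B.restrict.obj V)
    (p := fun y => B.orbit (V := B.tensorObj (B.tensorObj U V) W)
        (tmul (X := B.restrict.obj (B.tensorObj U V)) (Y := B.restrict.obj W) y w) ≫ f.hom =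
      B.orbit (V := B.tensorObj U (B.tensorObj V W))
        (f.hom (tmul (X := B.restrict.obj (B.tensorObj U V)) (Y := B.restrict.obj W) y w))) y
    ?_ (fun u v => ?_) (fun y y' h h' => ?_)
  · have h : tmul (X := B.restrict.obj (B.tensorObj U V)) (Y := B.restrict.obj W) 0 w = 0 :=
      map_zero ((tmulHom (B.restrict.obj (B.tensorObj U V)) (B.restrict.obj W)).flip w)
    have h' := B.linear_zero f.hom
    exact h ▸ h'
  · exact Bialgebroid.coassoc_tensorHom B.comul B.coassoc (B.orbit (V := U) u)
      (B.orbit (V := V) v) (B.orbit (V := W) w) (B.muIso U V) (B.muIso _ W) (B.muIso V W)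
      (B.muIso U _)
  · have h₁ : tmul (X := B.restrict.obj (B.tensorObj U V)) (Y := B.restrict.obj W) (y + y') w =
        tmul (X := B.restrict.obj (B.tensorObj U V)) (Y := B.restrict.obj W) y w +
        tmul (X := B.restrict.obj (B.tensorObj U V)) (Y := B.restrict.obj W) y' w :=
      add_tmul _ _ _
    have h₂ := B.linear_add f.hom _ _ h h'
    exact h₁ ▸ h₂

theorem orbit_unit (r : R) :
    B.orbit (V := B.tensorUnit) r = B.leftMul (B.source r) ≫ B.counit ≫ B.epsIso.hom :=
  rfl

theorem counit_target_eq (r : R) (a : A) :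
    B.counit (B.target (op r) * a : A) = B.counit (B.source r * a : A) := by
  have h := B.counit_target_mul (B.source r) a
  rwa [counit_source] at h

theorem orbit_unit' (r : R) :
    B.orbit (V := B.tensorUnit) r = B.leftMul (B.target (op r)) ≫ B.counit ≫ B.epsIso.hom :=
  hom_ext fun a => (B.counit_target_eq r a).symm

theorem comul_takeuchi (r : R) :
    B.comul ≫ (B.leftMul (B.source r) ⊗ₘ 𝟙 _) =
      B.comul ≫ (𝟙 _ ⊗ₘ B.leftMul (B.target (op r))) :=
  hom_ext fun a => B.comul_mem a r

theorem leftUnitor_linear (V : ModuleCat.{u} Aᵐᵒᵖ) (z : B.tensorObj B.tensorUnit V) :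
    let f : B.restrict.obj (B.tensorObj B.tensorUnit V) ≅ B.restrict.obj V :=
      ((B.muIso _ _).symm ≪≫ (B.epsIso.symm ⊗ᵢ .refl _)) ≪≫ λ_ (B.restrict.obj V)
    B.orbit z ≫ f.hom = B.orbit (V := V) (f.hom z) := by
  intro f
  refine B.linear_of_tmul f.hom (fun r v => ?_) z
  exact (Bialgebroid.counit_left_tensorHom B.comul B.counit B.counit_left _ _
    (B.comul_takeuchi r) (B.orbit (V := V) v) B.epsIso (B.muIso _ V)).trans
      (B.orbit_target (V := V) v r).symm

theorem rightUnitor_linear (V : ModuleCat.{u} Aᵐᵒᵖ) (z : B.tensorObj V B.tensorUnit) :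
    let f : B.restrict.obj (B.tensorObj V B.tensorUnit) ≅ B.restrict.obj V :=
      ((B.muIso _ _).symm ≪≫ (.refl _ ⊗ᵢ B.epsIso.symm)) ≪≫ ρ_ (B.restrict.obj V)
    B.orbit z ≫ f.hom = B.orbit (V := V) (f.hom z) := by
  intro f
  refine B.linear_of_tmul f.hom (fun v r => ?_) z
  have h := Bialgebroid.counit_right_tensorHom B.comul B.counit B.counit_right _ _
    (B.comul_takeuchi r) (B.orbit (V := V) v) B.epsIso (B.muIso V _)
  exact (congrArg (fun q => (B.comul ≫ (B.orbit (V := V) v ⊗ₘ q) ≫ (B.muIso _ _).hom) ≫ f.hom)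
    (B.orbit_unit' r)).trans (h.trans (B.orbit_source (V := V) v r).symm)

/-- The category of right `A`-modules, with the monoidal structure defined by `B`. -/
def Mod (_ : Bialgebroid R A) : Type (u + 1) := ModuleCat.{u} Aᵐᵒᵖ

instance : Category B.Mod := inferInstanceAs (Category (ModuleCat.{u} Aᵐᵒᵖ))

/-- The forgetful functor from right `A`-modules to `R`-`R`-bimodules. -/
def forget : B.Mod ⥤ BimodCat R := B.restrict

instance : B.forget.Faithful := inferInstanceAs B.restrict.Faithful

/-- The tensor product of right `A`-modules `V`, `W` is `V ⊗_R W` with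
`(v ⊗ w) a = v a₁ ⊗ w a₂`, the unit is `R` with `r a = π(s(r) a)`, and the tensor product of
morphisms, the associator and the unitors are those of bimodules. -/
instance : MonoidalCategoryStruct B.Mod where
  tensorObj V W := B.tensorObj V W
  whiskerLeft V W W' f := homOf (V := B.tensorObj V W) (W := B.tensorObj V W')
    ((B.muIso _ _).inv ≫ (B.restrict.obj V ◁ B.restrict.map f) ≫ (B.muIso _ _).hom)
    (B.tensorMap_linear (V := V) (𝟙 (show ModuleCat.{u} Aᵐᵒᵖ from V)) f)
  whiskerRight {V V'} f W := homOf (V := B.tensorObj V W) (W := B.tensorObj V' W)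
    ((B.muIso _ _).inv ≫ (B.restrict.map f ▷ B.restrict.obj W) ≫ (B.muIso _ _).hom)
    (B.tensorMap_linear (W := W) f (𝟙 (show ModuleCat.{u} Aᵐᵒᵖ from W)))
  tensorHom {V V' W W'} f g := homOf (V := B.tensorObj V W) (W := B.tensorObj V' W')
    ((B.muIso _ _).inv ≫ (B.restrict.map f ⊗ₘ B.restrict.map g) ≫ (B.muIso _ _).hom)
    (B.tensorMap_linear f g)
  tensorUnit := B.tensorUnit
  associator U V W := isoOf
    (V := B.tensorObj (B.tensorObj U V) W) (W := B.tensorObj U (B.tensorObj V W))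
    (((B.muIso _ _).symm ≪≫ ((B.muIso _ _).symm ⊗ᵢ .refl _))
        ≪≫ α_ (B.restrict.obj U) (B.restrict.obj V) (B.restrict.obj W)
        ≪≫ ((.refl _ ⊗ᵢ B.muIso _ _) ≪≫ B.muIso _ _)) (B.assoc_linear U V W)
  leftUnitor V := isoOf (V := B.tensorObj B.tensorUnit V) (W := V)
    (((B.muIso _ _).symm ≪≫ (B.epsIso.symm ⊗ᵢ .refl _)) ≪≫ λ_ (B.restrict.obj V))
    (B.leftUnitor_linear V)
  rightUnitor V := isoOf (V := B.tensorObj V B.tensorUnit) (W := V)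
    (((B.muIso _ _).symm ≪≫ (.refl _ ⊗ᵢ B.epsIso.symm)) ≪≫ ρ_ (B.restrict.obj V))
    (B.rightUnitor_linear V)

/-- The data exhibiting `B.forget` as strictly compatible with the tensor products: the
comparison maps `φ(V) ⊗ φ(W) → φ(V ⊗ W)` and `R → φ(R)` are identity maps. -/
def inducingData : Monoidal.InducingFunctorData B.forget where
  μIso V W := B.muIso V W
  whiskerLeft_eq _ _ _ _ := rfl
  whiskerRight_eq _ _ := rfl
  tensorHom_eq _ _ := rfl
  εIso := B.epsIso
  associator_eq _ _ _ := rfl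
  leftUnitor_eq _ := rfl
  rightUnitor_eq _ := rfl

instance : MonoidalCategory B.Mod := Monoidal.induced B.forget B.inducingData

/-- The forgetful functor is strictly monoidal. -/
instance : B.forget.Monoidal := Monoidal.fromInducedMonoidal B.forget B.inducingData

end Bialgebroid

/-! ### Additive bicategories, depth two, and the functor `Hom(g, _)` -/

/-- A bicategory whose hom-categories are preadditive and whose horizontal composition is
biadditive. -/
class PreadditiveBicategory (C : Type u) [Bicategory.{w, v} C] where
  homPreadditive : ∀ M N : C, Preadditive (M ⟶ N)
  whiskerLeft_add : ∀ {L M N : C} (f : L ⟶ M) {x y : M ⟶ N} (α β : x ⟶ y),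
    Bicategory.whiskerLeft f (α + β) = Bicategory.whiskerLeft f α + Bicategory.whiskerLeft f β
  add_whiskerRight : ∀ {L M N : C} {x y : L ⟶ M} (α β : x ⟶ y) (f : M ⟶ N),
    Bicategory.whiskerRight (α + β) f = Bicategory.whiskerRight α f + Bicategory.whiskerRight β f

attribute [reducible, instance] PreadditiveBicategory.homPreadditive

/-- `b` is a direct summand of a finite direct sum of copies of `g`. -/
def summandOfMultiple {D : Type*} [Category D] [Preadditive D] [Limits.HasFiniteBiproducts D]
    (g : D) : ObjectProperty D :=
  fun b => ∃ n : ℕ, Nonempty (Retract b (Limits.biproduct fun _ : Fin n => g))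

/-! In this namespace `a : N ⟶ M` is a 1-cell with left dual `aL = a^L : M ⟶ N`, unit
`η : 1_N ⟶ a a^L` and counit `ε : a^L a ⟶ 1_M`; 1-cells are composed in diagrammatic order, and
`g = a^L a : M ⟶ M`. The monoidal category of 1-cells `M ⟶ M` has composition as tensor product. -/

namespace DepthTwo

open Bicategory MulOpposite

variable {C : Type u} [Bicategory.{w, v} C] {N M : C}
  {a : N ⟶ M} {aL : M ⟶ N} (adj : a ⊣ aL)

/-- `r ↦ r^L`, the action on `End a` of the left dual functor. -/
def leftDual (r : a ⟶ a) : aL ⟶ aL := Bicategory.conjugateEquiv adj adj r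

theorem leftDual_eq (r : a ⟶ a) : leftDual adj r = (ρ_ _).inv ≫ aL ◁ adj.unit ≫ aL ◁ r ▷ aL ≫
  (α_ _ _ _).inv ≫ adj.counit ▷ aL ≫ (λ_ _).hom :=
  Bicategory.conjugateEquiv_apply' adj adj r

/-- The comultiplication `δ = a^L η a : g ⟶ g ⊗ g`; with the counit `ε` it makes `g` a comonoid. -/
def comul : aL ≫ a ⟶ (aL ≫ a) ≫ (aL ≫ a) :=
  aL ◁ ((λ_ a).inv ≫ adj.unit ▷ a ≫ (α_ a aL a).hom) ≫ (α_ aL a (aL ≫ a)).inv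

theorem comul_assoc : comul adj ≫ comul adj ▷ (aL ≫ a) ≫ (α_ _ _ _).hom = comul adj ≫ (aL ≫ a) ◁ comul adj := by
  unfold comul
  calc
    _ = 𝟙 _ ⊗≫ aL ◁ (𝟙 N ◁ adj.unit ≫ adj.unit ▷ (a ≫ aL)) ▷ a ⊗≫ 𝟙 _ := by bicategory
    _ = 𝟙 _ ⊗≫ aL ◁ (adj.unit ▷ 𝟙 N ≫ (a ≫ aL) ◁ adj.unit) ▷ a ⊗≫ 𝟙 _ := by
      rw [whisker_exchange]
    _ = _ := by bicategory

theorem comul_counit : comul adj ≫ (aL ≫ a) ◁ adj.counit = (ρ_ _).inv := by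
  unfold comul
  calc
    _ = 𝟙 _ ⊗≫ aL ◁ leftZigzag adj.unit adj.counit ⊗≫ 𝟙 _ := by bicategory
    _ = _ := by rw [adj.left_triangle]; bicategory

theorem counit_comul : comul adj ≫ adj.counit ▷ (aL ≫ a) = (λ_ _).inv := by
  unfold comul
  calc
    _ = 𝟙 _ ⊗≫ rightZigzag adj.unit adj.counit ▷ a ⊗≫ 𝟙 _ := by bicategory
    _ = _ := by rw [adj.right_triangle]; bicategory

theorem unit_leftDual (r : a ⟶ a) : adj.unit ≫ a ◁ leftDual adj r = adj.unit ≫ r ▷ aL := by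
  rw [leftDual_eq]
  calc
    _ = 𝟙 _ ⊗≫ (adj.unit ▷ 𝟙 N ≫ (a ≫ aL) ◁ (adj.unit ≫ r ▷ aL)) ⊗≫ a ◁ adj.counit ▷ aL ⊗≫ 𝟙 _ := by
      bicategory
    _ = 𝟙 _ ⊗≫ (𝟙 N ◁ (adj.unit ≫ r ▷ aL) ≫ adj.unit ▷ (a ≫ aL)) ⊗≫ a ◁ adj.counit ▷ aL ⊗≫ 𝟙 _ := by
      rw [whisker_exchange]
    _ = 𝟙 _ ⊗≫ (adj.unit ≫ r ▷ aL) ⊗≫ leftZigzag adj.unit adj.counit ▷ aL ⊗≫ 𝟙 _ := by bicategory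
    _ = _ := by rw [adj.left_triangle]; bicategory

theorem leftDual_counit (r : a ⟶ a) : leftDual adj r ▷ a ≫ adj.counit = aL ◁ r ≫ adj.counit := by
  rw [leftDual_eq]
  calc
    _ = 𝟙 _ ⊗≫ aL ◁ adj.unit ▷ a ⊗≫ aL ◁ r ▷ (aL ≫ a) ⊗≫ (adj.counit ▷ (aL ≫ a) ≫ 𝟙 M ◁ adj.counit) ⊗≫ 𝟙 _ := by
      bicategory
    _ = 𝟙 _ ⊗≫ aL ◁ adj.unit ▷ a ⊗≫ aL ◁ (r ▷ (aL ≫ a) ≫ a ◁ adj.counit) ⊗≫ adj.counit ▷ 𝟙 M ⊗≫ 𝟙 _ := by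
      rw [← whisker_exchange]; bicategory
    _ = 𝟙 _ ⊗≫ aL ◁ leftZigzag adj.unit adj.counit ⊗≫ aL ◁ r ⊗≫ adj.counit ⊗≫ 𝟙 _ := by
      rw [← whisker_exchange]; bicategory
    _ = _ := by rw [adj.left_triangle]; bicategory

theorem comul_balanced (r : a ⟶ a) : comul adj ≫ (aL ◁ r) ▷ (aL ≫ a) =
   comul adj ≫ (aL ≫ a) ◁ (leftDual adj r ▷ a) := by
  unfold comul
  calc
    _ = 𝟙 _ ⊗≫ aL ◁ (adj.unit ≫ r ▷ aL) ▷ a ⊗≫ 𝟙 _ := by bicategory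
    _ = 𝟙 _ ⊗≫ aL ◁ (adj.unit ≫ a ◁ leftDual adj r) ▷ a ⊗≫ 𝟙 _ := by rw [unit_leftDual]
    _ = _ := by bicategory

theorem comul_target (r : a ⟶ a) : leftDual adj r ▷ a ≫ comul adj =
   comul adj ≫ (leftDual adj r ▷ a) ▷ (aL ≫ a) := by
  unfold comul
  calc
    _ = 𝟙 _ ⊗≫ (leftDual adj r ▷ 𝟙 N ≫ aL ◁ adj.unit) ▷ a ⊗≫ 𝟙 _ := by bicategory
    _ = 𝟙 _ ⊗≫ (aL ◁ adj.unit ≫ leftDual adj r ▷ (a ≫ aL)) ▷ a ⊗≫ 𝟙 _ := by rw [← whisker_exchange]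
    _ = _ := by bicategory

theorem comul_source (r : a ⟶ a) : aL ◁ r ≫ comul adj =
   comul adj ≫ (aL ≫ a) ◁ (aL ◁ r) := by
  unfold comul
  calc
    _ = 𝟙 _ ⊗≫ aL ◁ (𝟙 N ◁ r ≫ adj.unit ▷ a) ⊗≫ 𝟙 _ := by bicategory
    _ = 𝟙 _ ⊗≫ aL ◁ (adj.unit ▷ a ≫ (a ≫ aL) ◁ r) ⊗≫ 𝟙 _ := by rw [whisker_exchange]
    _ = _ := by bicategory

theorem comul_tensor_assoc (b c d : M ⟶ M) (x : aL ≫ a ⟶ b) (y : aL ≫ a ⟶ c) (z : aL ≫ a ⟶ d) :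
    (comul adj ≫ ((comul adj ≫ (x ▷ (aL ≫ a) ≫ b ◁ y)) ▷ (aL ≫ a) ≫ (b ≫ c) ◁ z)) ≫
      (α_ b c d).hom =
    comul adj ≫ (x ▷ (aL ≫ a) ≫ b ◁ (comul adj ≫ (y ▷ (aL ≫ a) ≫ c ◁ z))) := by
  calc
    _ = (comul adj ≫ comul adj ▷ (aL ≫ a) ≫ (α_ _ _ _).hom) ≫
        x ▷ ((aL ≫ a) ≫ (aL ≫ a)) ≫ b ◁ (y ▷ (aL ≫ a) ≫ c ◁ z) := by
      simp
    _ = _ := by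
      rw [comul_assoc, Category.assoc, whisker_exchange_assoc, ← whiskerLeft_comp]

theorem comul_tensor_unit_left (b : M ⟶ M) (r : a ⟶ a) (x : aL ≫ a ⟶ b) :
    (comul adj ≫ ((aL ◁ r ≫ adj.counit) ▷ (aL ≫ a) ≫ 𝟙 M ◁ x)) ≫ (λ_ b).hom =
      leftDual adj r ▷ a ≫ x := by
  rw [← leftDual_counit, comp_whiskerRight, Category.assoc, Category.assoc, Category.assoc,
    ← Category.assoc, ← comul_target, Category.assoc, leftUnitor_naturality,
    ← Category.assoc (comul adj), counit_comul, Iso.inv_hom_id_assoc]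

theorem comul_tensor_unit_right (b : M ⟶ M) (r : a ⟶ a) (x : aL ≫ a ⟶ b) :
    (comul adj ≫ (x ▷ (aL ≫ a) ≫ b ◁ (aL ◁ r ≫ adj.counit))) ≫ (ρ_ b).hom =
      aL ◁ r ≫ x := by
  rw [← whisker_exchange, whiskerLeft_comp, Category.assoc, Category.assoc, Category.assoc,
    ← Category.assoc, ← comul_source, Category.assoc, rightUnitor_naturality,
    ← Category.assoc (comul adj), comul_counit, Iso.inv_hom_id_assoc]

theorem comul_tensor_natural_left {b b' c : M ⟶ M} (f : b ⟶ b') (x : aL ≫ a ⟶ b)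
    (y : aL ≫ a ⟶ c) :
    comul adj ≫ ((x ≫ f) ▷ (aL ≫ a) ≫ b' ◁ y) =
      (comul adj ≫ (x ▷ (aL ≫ a) ≫ b ◁ y)) ≫ f ▷ c := by
  simp [whisker_exchange]

theorem comul_tensor_natural_right {b c c' : M ⟶ M} (f : c ⟶ c') (x : aL ≫ a ⟶ b)
    (y : aL ≫ a ⟶ c) :
    comul adj ≫ (x ▷ (aL ≫ a) ≫ b ◁ (y ≫ f)) =
      (comul adj ≫ (x ▷ (aL ≫ a) ≫ b ◁ y)) ≫ b ◁ f := by
  simp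

section

variable [PreadditiveBicategory C]

theorem leftDual_add (r s : a ⟶ a) : leftDual adj (r + s) = leftDual adj r + leftDual adj s := by
  simp only [leftDual_eq, PreadditiveBicategory.whiskerLeft_add,
    PreadditiveBicategory.add_whiskerRight, Preadditive.add_comp, Preadditive.comp_add]

/-- The ring homomorphisms `s(r) = a^L r` and `t(r) = r^L a` (whiskerings) from
`R = End a` to `A = End g`. -/
def sourceTarget : SourceTarget (End a) (End (aL ≫ a)) where
  source := RingHom.mk'
    { toFun := fun r : a ⟶ a => (aL ◁ r : aL ≫ a ⟶ aL ≫ a)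
      map_one' := whiskerLeft_id aL a
      map_mul' := fun r r' => whiskerLeft_comp aL (show a ⟶ a from r') (show a ⟶ a from r) }
    (fun r r' => PreadditiveBicategory.whiskerLeft_add aL (show a ⟶ a from r) r')
  target := RingHom.mk'
    { toFun := fun r => (leftDual adj r.unop ▷ a : aL ≫ a ⟶ aL ≫ a)
      map_one' := by
        change leftDual adj (𝟙 a) ▷ a = 𝟙 _
        rw [leftDual, Bicategory.conjugateEquiv_id, id_whiskerRight]
      map_mul' := fun r r' => by
        change leftDual adj ((show a ⟶ a from r.unop) ≫ (show a ⟶ a from r'.unop)) ▷ a =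
          leftDual adj r'.unop ▷ a ≫ leftDual adj r.unop ▷ a
        rw [leftDual, ← Bicategory.conjugateEquiv_comp adj adj adj, comp_whiskerRight]
        rfl }
    (fun r r' => (congrArg (· ▷ a) (leftDual_add adj r.unop r'.unop)).trans
      (PreadditiveBicategory.add_whiskerRight _ _ a))
  commute r r' := (whisker_exchange (leftDual adj r'.unop) (show a ⟶ a from r)).symm

/-- The functor `Hom(g, _)` from the monoidal category of endo-1-cells of `M` to
`R`-`R`-bimodules, with `r · h = h ∘ (r^L a)` and `h · r = h ∘ (a^L r)`. It factors through
the functor `Hom(g, _)` to right `A`-modules. -/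
def homFunctor : (M ⟶ M) ⥤ BimodCat (End a) :=
  preadditiveCoyonedaObj (aL ≫ a) ⋙ (sourceTarget adj).restrict

theorem homFunctor_smul (b : M ⟶ M) (r : End a) (h : (homFunctor adj).obj b) :
    r • h = ((leftDual adj r ▷ a) ≫ (show aL ≫ a ⟶ b from h) : aL ≫ a ⟶ b) := rfl

theorem homFunctor_op_smul (b : M ⟶ M) (r : End a) (h : (homFunctor adj).obj b) :
    op r • h = ((aL ◁ (show a ⟶ a from r)) ≫ (show aL ≫ a ⟶ b from h) : aL ≫ a ⟶ b) := rfl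

/-- The morphism `R → Hom(g, 1_M)`, `r ↦ ε ∘ (a^L r)`. -/
def homUnit : BimodCat.regular (End a) ⟶ (homFunctor adj).obj (𝟙 M) :=
  BimodCat.ofHom (Y := (homFunctor adj).obj (𝟙 M))
    (AddMonoidHom.mk' (fun r : a ⟶ a => (aL ◁ r ≫ adj.counit : aL ≫ a ⟶ 𝟙 M)) (fun r s => by
      rw [PreadditiveBicategory.whiskerLeft_add, Preadditive.add_comp]; rfl))
    (fun r s => by
      change aL ◁ ((show a ⟶ a from s) ≫ (show a ⟶ a from r)) ≫ adj.counit =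
        leftDual adj r ▷ a ≫ aL ◁ (show a ⟶ a from s) ≫ adj.counit
      rw [whiskerLeft_comp, Category.assoc, ← leftDual_counit, whisker_exchange_assoc])
    (fun r s => by
      change aL ◁ ((show a ⟶ a from r) ≫ (show a ⟶ a from s)) ≫ adj.counit =
        aL ◁ (show a ⟶ a from r) ≫ aL ◁ (show a ⟶ a from s) ≫ adj.counit
      rw [whiskerLeft_comp, Category.assoc])

theorem comul_tensor_add_left {b c : M ⟶ M} (x x' : aL ≫ a ⟶ b) (y : aL ≫ a ⟶ c) :
    comul adj ≫ ((x + x') ▷ (aL ≫ a) ≫ b ◁ y) =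
      comul adj ≫ (x ▷ (aL ≫ a) ≫ b ◁ y) + comul adj ≫ (x' ▷ (aL ≫ a) ≫ b ◁ y) := by
  rw [PreadditiveBicategory.add_whiskerRight, Preadditive.add_comp, Preadditive.comp_add]

theorem comul_tensor_add_right {b c : M ⟶ M} (x : aL ≫ a ⟶ b) (y y' : aL ≫ a ⟶ c) :
    comul adj ≫ (x ▷ (aL ≫ a) ≫ b ◁ (y + y')) =
      comul adj ≫ (x ▷ (aL ≫ a) ≫ b ◁ y) + comul adj ≫ (x ▷ (aL ≫ a) ≫ b ◁ y') := by
  rw [PreadditiveBicategory.whiskerLeft_add, Preadditive.comp_add, Preadditive.comp_add]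

/-- The morphism `Hom(g, b) ⊗_R Hom(g, c) → Hom(g, b ⊗ c)`, `x ⊗ y ↦ (x ⊗ y) ∘ δ`. -/
def homTensor (b c : M ⟶ M) :
    BimodCat.tensor ((homFunctor adj).obj b) ((homFunctor adj).obj c) ⟶
      (homFunctor adj).obj (b ≫ c) :=
  BimodCat.tensorLift (Z := (homFunctor adj).obj (b ≫ c))
    (AddMonoidHom.mk' (fun x : aL ≫ a ⟶ b => AddMonoidHom.mk' (fun y : aL ≫ a ⟶ c =>
        (comul adj ≫ (x ▷ (aL ≫ a) ≫ b ◁ y) : aL ≫ a ⟶ b ≫ c))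
      (fun y y' => comul_tensor_add_right adj x y y'))
      (fun x x' => AddMonoidHom.ext fun y => comul_tensor_add_left adj x x' y))
    (fun x r y => by
      change comul adj ≫ (aL ◁ (show a ⟶ a from r) ≫ (show aL ≫ a ⟶ b from x)) ▷ (aL ≫ a) ≫
          b ◁ (show aL ≫ a ⟶ c from y) =
        comul adj ≫ (show aL ≫ a ⟶ b from x) ▷ (aL ≫ a) ≫
          b ◁ (leftDual adj r ▷ a ≫ (show aL ≫ a ⟶ c from y))
      rw [comp_whiskerRight, Category.assoc, ← Category.assoc, comul_balanced, whiskerLeft_comp,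
        Category.assoc, whisker_exchange_assoc])
    (fun r x y => by
      change comul adj ≫ (leftDual adj r ▷ a ≫ (show aL ≫ a ⟶ b from x)) ▷ (aL ≫ a) ≫
          b ◁ (show aL ≫ a ⟶ c from y) =
        leftDual adj r ▷ a ≫ comul adj ≫ (show aL ≫ a ⟶ b from x) ▷ (aL ≫ a) ≫
          b ◁ (show aL ≫ a ⟶ c from y)
      rw [comp_whiskerRight, Category.assoc, ← Category.assoc, ← comul_target, Category.assoc])
    (fun r x y => by
      change comul adj ≫ (show aL ≫ a ⟶ b from x) ▷ (aL ≫ a) ≫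
          b ◁ (aL ◁ (show a ⟶ a from r) ≫ (show aL ≫ a ⟶ c from y)) =
        aL ◁ (show a ⟶ a from r) ≫ comul adj ≫ (show aL ≫ a ⟶ b from x) ▷ (aL ≫ a) ≫
          b ◁ (show aL ≫ a ⟶ c from y)
      rw [whiskerLeft_comp, ← whisker_exchange_assoc, ← Category.assoc, ← comul_source,
        Category.assoc])

theorem homTensor_tmul (b c : M ⟶ M) (x : aL ≫ a ⟶ b) (y : aL ≫ a ⟶ c) :
    homTensor adj b c (BimodCat.Tensor.tmul (X := (homFunctor adj).obj b)
      (Y := (homFunctor adj).obj c) x y) =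
      (comul adj ≫ (x ▷ (aL ≫ a) ≫ b ◁ y) : aL ≫ a ⟶ b ≫ c) := rfl

end

end DepthTwo

namespace DepthTwo

variable {C : Type u} [Bicategory.{w, v} C] [PreadditiveBicategory C] {N M : C}
  {a : N ⟶ M} {aL : M ⟶ N} (adj : Bicategory.Adjunction a aL)

/-- The (lax) monoidal structure on the functor `Hom(g, _)`. -/
instance homFunctorLaxMonoidal : (homFunctor adj).LaxMonoidal where
  ε := homUnit adj
  μ b c := homTensor adj b c
  μ_natural_left f _ := BimodCat.tensor_hom_ext fun x y =>
    comul_tensor_natural_left adj f x y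
  μ_natural_right _ f := BimodCat.tensor_hom_ext fun x y =>
    comul_tensor_natural_right adj f x y
  associativity b c d := BimodCat.tensor₃_hom_ext fun x y z => comul_tensor_assoc adj b c d x y z
  left_unitality b := BimodCat.tensor_hom_ext fun r x => (comul_tensor_unit_left adj b r x).symm
  right_unitality b := BimodCat.tensor_hom_ext fun x r => (comul_tensor_unit_right adj b r x).symm

/-- The 1-cell `a` is of depth 2: `a a^L a` is a direct summand of a finite direct sum of copies
of `a`. -/
def IsDepthTwo [∀ M N : C, Limits.HasFiniteBiproducts (M ⟶ N)] (_ : Bicategory.Adjunction a aL) :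
    Prop :=
  summandOfMultiple a (a ≫ aL ≫ a)

/-- The objects of `C_g`: the direct summands of finite direct sums of copies of `g`. -/
abbrev Cg [∀ M N : C, Limits.HasFiniteBiproducts (M ⟶ N)] (_ : Bicategory.Adjunction a aL) :
    ObjectProperty (M ⟶ M) :=
  summandOfMultiple (aL ≫ a)

/-- The functor `Hom(g, _)` from endo-1-cells of `M` to right `A`-modules, for `A = End g` with the
action `h · x = h ∘ x`. -/
def homMod {R : Type w} [Ring R] (B : Bialgebroid R (End (aL ≫ a))) : (M ⟶ M) ⥤ B.Mod :=
  preadditiveCoyonedaObj (aL ≫ a)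

end DepthTwo

/-- The finitely generated projective right `A`-modules. -/
def Bialgebroid.fgp {R A : Type u} [Ring R] [Ring A] (B : Bialgebroid R A) :
    ObjectProperty B.Mod :=
  fun V : ModuleCat.{u} Aᵐᵒᵖ => Module.Finite Aᵐᵒᵖ V ∧ Module.Projective Aᵐᵒᵖ V

/-! The adjunction identifies Hom(g, b) with Hom(a, a b). In this form R acts on the right by
precomposition and on the left by postcomposition with whiskered endomorphisms of a. The map μ
becomes the composite a → a c → a b c (`homEquiv₁_mul`), and ν becomes End a ≅ Hom(a, a 1). So ν is
always bijective (`homUnit_bijective`). The map μ_{b,c} is bijective as soon as the identity of a b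
is a finite sum of composites of maps p_k : a b → a and i_k : a → a b. These form a dual basis of
the right R-module Hom(a, a b), and h ↦ ∑ i_k ⊗ (h followed by p_k c) inverts μ
(`homTensor_bijective`). Depth two provides such a sum for every b in C_g, so F is strong monoidal
on C_g.

Now g is a comonoid with structure maps δ and ε, hence A = F(g) is a comonoid in bimodules: γ and π
are the solutions of μ(γ(x)) = δ ∘ x and ν(π(x)) = ε ∘ x. The other bialgebroid axioms are checked
after applying the injections μ and ν. The main tool is `act_homTensor`: by naturality of μ, acting
by γ(w) on F(b) ⊗ F(c) corresponds to precomposing with w. This also says that μ is A-linear, and ν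
is A-linear likewise, so the structure maps of F lift to G. That G is an equivalence is the usual
projectivization argument, with idempotents split in C(M, M).

For uniqueness, let B be any structure as in the theorem. The bimodule structure of F(g), evaluated
at the identity of g, determines s and t. The structure maps of G are A-linear with underlying maps
μ and ν; since (1 ⊗ 1)w = γ(w) and 1·w = π(w), linearity forces the two defining equations of γ and
π, and these have only one solution. -/

/-! ### Direct summands of multiples, in terms of sums of composites. -/

section SummandOfMultiple

variable {D : Type*} [Category D] [Preadditive D]

/-- The identity of `b` is a finite sum of endomorphisms that factor through `g`. -/
def FactorsThrough (g b : D) : Prop :=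
  ∃ (n : ℕ) (i : Fin n → (b ⟶ g)) (p : Fin n → (g ⟶ b)), ∑ k, i k ≫ p k = 𝟙 b

theorem FactorsThrough.of_fintype {g b : D} {ι : Type*} [Fintype ι] (i : ι → (b ⟶ g))
    (p : ι → (g ⟶ b)) (h : ∑ k, i k ≫ p k = 𝟙 b) : FactorsThrough g b := by
  classical
  refine ⟨Fintype.card ι, fun k => i ((Fintype.equivFin ι).symm k),
    fun k => p ((Fintype.equivFin ι).symm k), ?_⟩
  rw [← h]
  exact (Fintype.equivFin ι).symm.sum_comp fun k => i k ≫ p k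

theorem FactorsThrough.self (g : D) : FactorsThrough g g :=
  ⟨1, fun _ => 𝟙 g, fun _ => 𝟙 g, by simp⟩

theorem FactorsThrough.trans {g b c : D} (h : FactorsThrough g b) (h' : FactorsThrough b c) :
    FactorsThrough g c := by
  obtain ⟨n, i, p, e⟩ := h
  obtain ⟨n', i', p', e'⟩ := h'
  refine .of_fintype (fun k : Fin n' × Fin n => i' k.1 ≫ i k.2) (fun k => p k.2 ≫ p' k.1) ?_
  rw [Fintype.sum_prod_type, ← e']
  refine Finset.sum_congr rfl fun k _ => ?_
  calc ∑ l, (i' k ≫ i l) ≫ p l ≫ p' k = i' k ≫ (∑ l, i l ≫ p l) ≫ p' k := by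
        simp [Preadditive.comp_sum, Preadditive.sum_comp]
    _ = i' k ≫ p' k := by rw [e, Category.id_comp]

/-- A finite sum of composites is preserved by any additive functor, without comparing biproducts.
The functors meant are the whiskerings by a 1-cell. -/
theorem FactorsThrough.map {E : Type*} [Category E] [Preadditive E] (F : D ⥤ E) [F.Additive]
    {g b : D} (h : FactorsThrough g b) : FactorsThrough (F.obj g) (F.obj b) := by
  obtain ⟨n, i, p, e⟩ := h
  refine ⟨n, fun k => F.map (i k), fun k => F.map (p k), ?_⟩
  rw [← F.map_id, ← e, F.map_sum]
  simp

theorem FactorsThrough.of_retract {g b : D} (r : Retract b g) : FactorsThrough g b :=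
  ⟨1, fun _ => r.i, fun _ => r.r, by simp⟩

variable [Limits.HasFiniteBiproducts D]

/-- The maps i_k and p_k are the components of the inclusion into a sum of copies of g and of the
retraction from it. -/
theorem summandOfMultiple_iff {g b : D} : summandOfMultiple g b ↔ FactorsThrough g b := by
  constructor
  · rintro ⟨n, ⟨r⟩⟩
    refine FactorsThrough.trans ⟨n, fun k => Limits.biproduct.π (fun _ : Fin n => g) k,
      fun k => Limits.biproduct.ι (fun _ : Fin n => g) k, Limits.biproduct.total⟩ (.of_retract r)
  · rintro ⟨n, i, p, e⟩
    exact ⟨n, ⟨⟨Limits.biproduct.lift i, Limits.biproduct.desc p, by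
      rw [Limits.biproduct.lift_desc, e]⟩⟩⟩

end SummandOfMultiple

/-! ### Transposition along the adjunction, and bijectivity of μ and ν. -/

namespace DepthTwo

open Bicategory MulOpposite

section

variable {C : Type u} [Bicategory.{w, v} C] {N M : C}
  {a : N ⟶ M} {aL : M ⟶ N} (adj : a ⊣ aL)

theorem homEquiv₁_comp_left {b : M ⟶ M} (r : a ⟶ a) (x : a ⟶ a ≫ b) :
    adj.homEquiv₁ (r ≫ x) = aL ◁ r ≫ adj.homEquiv₁ x := by
  simp [Adjunction.homEquiv₁_apply]

/-- This is the left R-action on Hom(a, a c): r slides down to the counit, where `leftDual_counit`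
trades it for r^L. -/
theorem homEquiv₁_comp_whiskerRight {c : M ⟶ M} (r : a ⟶ a) (y : a ⟶ a ≫ c) :
    adj.homEquiv₁ (y ≫ r ▷ c) = leftDual adj r ▷ a ≫ adj.homEquiv₁ y := by
  simp only [Adjunction.homEquiv₁_apply, whiskerLeft_comp, Category.assoc]
  rw [← whisker_exchange_assoc, associator_inv_naturality_left_assoc,
    associator_inv_naturality_middle_assoc, ← comp_whiskerRight_assoc, ← comp_whiskerRight_assoc,
    leftDual_counit]

/-- The right side is μ(x ⊗ y) in terms of transposes; so μ is composition of 1-cell maps out of a,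
which is what makes it easy to invert. -/
theorem homEquiv₁_mul {b c : M ⟶ M} (x : a ⟶ a ≫ b) (y : a ⟶ a ≫ c) :
    adj.homEquiv₁ (y ≫ x ▷ c ≫ (α_ a b c).hom) =
      comul adj ≫ adj.homEquiv₁ x ▷ (aL ≫ a) ≫ b ◁ adj.homEquiv₁ y := by
  -- With y written as the inverse transpose of z, this is the definition of δ.
  have h : comul adj ≫ (aL ≫ a) ◁ adj.homEquiv₁ y = aL ◁ y ≫ (α_ aL a c).inv := by
    rw [← adj.homEquiv₁.symm_apply_apply y]
    generalize adj.homEquiv₁ y = z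
    rw [Equiv.apply_symm_apply, Adjunction.homEquiv₁_symm_apply]
    simp [comul]
  rw [← whisker_exchange, reassoc_of% h]
  simp [Adjunction.homEquiv₁_apply]

end

section

variable {C : Type u} [Bicategory.{w, v} C] [PreadditiveBicategory C] {N M : C}
  {a : N ⟶ M} {aL : M ⟶ N} (adj : a ⊣ aL)

theorem precomp_additive {L : C} (f : N ⟶ M) : (precomp L f).Additive where
  map_add := PreadditiveBicategory.whiskerLeft_add _ _ _

theorem postcomp_additive {L : C} (f : N ⟶ M) : (postcomp L f).Additive where
  map_add := PreadditiveBicategory.add_whiskerRight _ _ _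

theorem homEquiv₁_add {b : M ⟶ M} (x y : a ⟶ a ≫ b) :
    adj.homEquiv₁ (x + y) = adj.homEquiv₁ x + adj.homEquiv₁ y := by
  simp only [Adjunction.homEquiv₁_apply, PreadditiveBicategory.whiskerLeft_add,
    Preadditive.add_comp]

/-- The bijection `Hom(a, a b) ≃ Hom(g, b)` as an isomorphism of groups. -/
def adjunctEquiv (b : M ⟶ M) : (a ⟶ a ≫ b) ≃+ (aL ≫ a ⟶ b) :=
  { adj.homEquiv₁ with map_add' := homEquiv₁_add adj }

/-- The map `h ↦ h̃ ≫ (p ▷ c)` on adjuncts. -/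
def adjunctComp {b c : M ⟶ M} (p : a ≫ b ⟶ a) :
    (aL ≫ a ⟶ b ≫ c) →+ (aL ≫ a ⟶ c) :=
  (adjunctEquiv adj c).toAddMonoidHom.comp
    ((Preadditive.rightComp a ((α_ a b c).inv ≫ p ▷ c)).comp
      (adjunctEquiv adj (b ≫ c)).symm.toAddMonoidHom)

/-- In Hom(a, a b c) the product is y followed by x c; composing further with p c leaves y followed
by (x ≫ p) c, the left action of the scalar x ≫ p in End a. -/
theorem adjunctComp_mul {b c : M ⟶ M} (p : a ≫ b ⟶ a) (x : a ⟶ a ≫ b) (y : aL ≫ a ⟶ c) :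
    adjunctComp adj p (comul adj ≫ adj.homEquiv₁ x ▷ (aL ≫ a) ≫ b ◁ y) =
      leftDual adj (x ≫ p) ▷ a ≫ y := by
  obtain ⟨y, rfl⟩ := adj.homEquiv₁.surjective y
  rw [← homEquiv₁_mul, ← homEquiv₁_comp_whiskerRight]
  change adj.homEquiv₁ (adj.homEquiv₁.symm (adj.homEquiv₁ _) ≫ _) = _
  rw [Equiv.symm_apply_apply]
  simp

/-- Multiplying back by i inserts p ≫ i, whiskered by c, after h. Summed over a decomposition of the
identity of a b, this returns h. -/
theorem mul_adjunctComp {b c : M ⟶ M} (i : a ⟶ a ≫ b) (p : a ≫ b ⟶ a) (h : a ⟶ a ≫ b ≫ c) :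
    comul adj ≫ adj.homEquiv₁ i ▷ (aL ≫ a) ≫ b ◁ adjunctComp adj p (adj.homEquiv₁ h) =
      adj.homEquiv₁ (h ≫ (α_ a b c).inv ≫ (p ≫ i) ▷ c ≫ (α_ a b c).hom) := by
  change comul adj ≫ adj.homEquiv₁ i ▷ (aL ≫ a) ≫
    b ◁ adj.homEquiv₁ (adj.homEquiv₁.symm (adj.homEquiv₁ h) ≫ _) = _
  rw [Equiv.symm_apply_apply, ← homEquiv₁_mul]
  simp

/-- The dual basis argument: the inverse is h ↦ ∑ i_k ⊗ `adjunctComp` p_k h. The condition concerns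
b alone; c is arbitrary. -/
theorem homTensor_bijective {b : M ⟶ M} (h : FactorsThrough a (a ≫ b)) (c : M ⟶ M) :
    Function.Bijective (homTensor adj b c) := by
  -- Here p k : a b → a comes first and i k : a → a b second.
  obtain ⟨n, p, i, e⟩ := h
  let X := (homFunctor adj).obj b
  let Y := (homFunctor adj).obj c
  constructor
  · let Ψ : (aL ≫ a ⟶ b ≫ c) →+ BimodCat.Tensor X Y :=
      ∑ k, (BimodCat.Tensor.tmulHom X Y (adj.homEquiv₁ (i k))).comp (adjunctComp adj (p k))
    have hΨ : Ψ.comp (homTensor adj b c).toAddHom = AddMonoidHom.id _ := by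
      refine BimodCat.Tensor.addHom_ext fun x y => ?_
      obtain ⟨x, rfl⟩ := (adjunctEquiv adj b).surjective x
      change Ψ (comul adj ≫ adj.homEquiv₁ x ▷ (aL ≫ a) ≫ b ◁ y) = _
      simp only [Ψ, AddMonoidHom.finsetSum_apply]
      have h₁ : ∀ k, BimodCat.Tensor.tmulHom X Y (adj.homEquiv₁ (i k))
          (adjunctComp adj (p k) (comul adj ≫ adj.homEquiv₁ x ▷ (aL ≫ a) ≫ b ◁ y)) =
          BimodCat.Tensor.tmul (X := X) (Y := Y) (adjunctEquiv adj b (x ≫ p k ≫ i k)) y := by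
        intro k
        refine (congrArg (BimodCat.Tensor.tmulHom X Y (adj.homEquiv₁ (i k)))
          (adjunctComp_mul adj (p k) x y)).trans ?_
        -- The scalar x ≫ p k moves across ⊗_R from y to i k, where it gives x ≫ p k ≫ i k; these
        -- add up to x.
        refine (BimodCat.Tensor.smul_tmul (X := X) (Y := Y) (adj.homEquiv₁ (i k))
          (x ≫ p k : a ⟶ a) y).symm.trans (congrArg (BimodCat.Tensor.tmul (X := X) · y) ?_)
        refine (homEquiv₁_comp_left adj (x ≫ p k) (i k)).symm.trans ?_
        rw [Category.assoc]; rfl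
      refine (Finset.sum_congr rfl fun k _ => h₁ k).trans ?_
      refine (map_sum (((BimodCat.Tensor.tmulHom X Y).flip y).comp
        (adjunctEquiv adj b).toAddMonoidHom) (fun k => x ≫ p k ≫ i k) Finset.univ).symm.trans ?_
      rw [← Preadditive.comp_sum, e, Category.comp_id]
      rfl
    exact Function.LeftInverse.injective (g := Ψ) (DFunLike.congr_fun hΨ)
  · intro h
    obtain ⟨h, rfl⟩ := (adjunctEquiv adj (b ≫ c)).surjective h
    refine ⟨∑ k, BimodCat.Tensor.tmul (X := X) (Y := Y) (adj.homEquiv₁ (i k))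
      (adjunctComp adj (p k) (adj.homEquiv₁ h)), ?_⟩
    refine (map_sum (homTensor adj b c).toAddHom _ _).trans ?_
    refine (Finset.sum_congr rfl fun k _ => mul_adjunctComp adj (i k) (p k) h).trans ?_
    refine (map_sum (adjunctEquiv adj (b ≫ c)) _ _).symm.trans (congrArg _ ?_)
    rw [← Preadditive.comp_sum, ← Preadditive.comp_sum, ← Preadditive.sum_comp]
    have := postcomp_additive (L := N) c
    have h₂ : ∑ k, (p k ≫ i k) ▷ c = 𝟙 ((a ≫ b) ≫ c) := by
      rw [← id_whiskerRight, ← e]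
      exact ((postcomp N c).map_sum _ _).symm
    rw [h₂]
    simp

/-- Up to the right unitor of a, ν is the transposition Hom(a, a 1) ≅ Hom(g, 1). -/
theorem homUnit_bijective : Function.Bijective (homUnit adj) := by
  have h : ∀ r : a ⟶ a, homUnit adj r = adj.homEquiv₁ (r ≫ (ρ_ a).inv) := by
    intro r
    change aL ◁ r ≫ adj.counit = _
    simp [Adjunction.homEquiv₁_apply]
  have h₁ : (homUnit adj : (a ⟶ a) → (aL ≫ a ⟶ 𝟙 M)) =
    adj.homEquiv₁ ∘ ((Iso.refl a).homCongr (ρ_ a).symm) :=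
      funext fun r => (h r).trans (congrArg _ (Category.id_comp _).symm)
  exact h₁ ▸ (adj.homEquiv₁.bijective.comp (Equiv.bijective _))

end
end DepthTwo

/-! ### Comonoids carried along a lax monoidal functor. -/

section

open MonoidalCategory Functor.LaxMonoidal

variable {C D : Type*} [Category C] [Category D] [MonoidalCategory C] [MonoidalCategory D]
  (F : C ⥤ D) [F.LaxMonoidal] {g : C} (δ : g ⟶ g ⊗ g) (e : g ⟶ 𝟙_ C)
  (γ : F.obj g ⟶ F.obj g ⊗ F.obj g) (π : F.obj g ⟶ 𝟙_ D)

/-- After composing with μ twice, both sides become the image under F of the coassociativity of δ;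
the two isomorphisms allow μ to be cancelled. The counit laws below end in F(g) itself, so nothing
has to be cancelled there. -/
theorem coassoc_of_laxMonoidal [IsIso (μ F g g)] [IsIso (μ F g (g ⊗ g))]
    (h : γ ≫ μ F g g = F.map δ) (hδ : δ ≫ δ ▷ g ≫ (α_ g g g).hom = δ ≫ g ◁ δ) :
    γ ≫ γ ▷ F.obj g ≫ (α_ (F.obj g) (F.obj g) (F.obj g)).hom = γ ≫ F.obj g ◁ γ := by
  rw [← cancel_mono (F.obj g ◁ μ F g g), ← cancel_mono (μ F g (g ⊗ g))]
  have h₁ := congrArg F.map hδ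
  simp only [F.map_comp] at h₁
  simp only [Category.assoc]
  rw [← associativity, ← comp_whiskerRight_assoc, ← whiskerLeft_comp_assoc, h,
    μ_natural_right, μ_natural_left_assoc, reassoc_of% h, reassoc_of% h, h₁]

theorem counit_left_of_laxMonoidal (h : γ ≫ μ F g g = F.map δ) (hπ : π ≫ ε F = F.map e)
    (hδ : δ ≫ e ▷ g = (λ_ g).inv) :
    γ ≫ π ▷ F.obj g ≫ (λ_ (F.obj g)).hom = 𝟙 (F.obj g) := by
  rw [left_unitality, ← comp_whiskerRight_assoc, hπ, μ_natural_left_assoc, reassoc_of% h,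
    ← F.map_comp, ← F.map_comp, ← Category.assoc, hδ, Iso.inv_hom_id, F.map_id]

theorem counit_right_of_laxMonoidal (h : γ ≫ μ F g g = F.map δ) (hπ : π ≫ ε F = F.map e)
    (hδ : δ ≫ g ◁ e = (ρ_ g).inv) :
    γ ≫ F.obj g ◁ π ≫ (ρ_ (F.obj g)).hom = 𝟙 (F.obj g) := by
  rw [right_unitality, ← whiskerLeft_comp_assoc, hπ, μ_natural_right_assoc, reassoc_of% h,
    ← F.map_comp, ← F.map_comp, ← Category.assoc, hδ, Iso.inv_hom_id, F.map_id]

end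

namespace BimodCat

variable {R : Type u} [Ring R]

theorem isIso_of_bijective {X Y : BimodCat R} (f : X ⟶ Y) (h : Function.Bijective f) :
    IsIso f := by
  let e : X ≃+ Y := AddEquiv.ofBijective f.toAddHom h
  have he : ∀ y, f (e.symm y) = y := e.apply_symm_apply
  exact ⟨ofHom e.symm.toAddMonoidHom
      (fun r y => h.1 ((he (r • y)).trans
        ((hom_smul f r (e.symm y)).trans (congrArg (r • ·) (he y))).symm))
      (fun r y => h.1 ((he (MulOpposite.op r • y)).trans
        ((hom_op_smul f r (e.symm y)).trans (congrArg (MulOpposite.op r • ·) (he y))).symm)),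
    hom_ext e.symm_apply_apply, hom_ext he⟩

end BimodCat

/-! ### The bialgebroid structure on End g. -/

namespace DepthTwo

open Bicategory MulOpposite BimodCat BimodCat.Tensor

variable {C : Type u} [Bicategory.{w, v} C] [PreadditiveBicategory C] {N M : C}
  {a : N ⟶ M} {aL : M ⟶ N} (adj : Bicategory.Adjunction a aL)

theorem isIso_homUnit : IsIso (homUnit adj) := isIso_of_bijective _ (homUnit_bijective adj)

theorem isIso_homTensor {b : M ⟶ M} (h : FactorsThrough a (a ≫ b)) (c : M ⟶ M) :
    IsIso (homTensor adj b c) := isIso_of_bijective _ (homTensor_bijective adj h c)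

/-- On x ⊗ y the action of z is (F(x) ⊗ F(y))(z), so naturality of μ gives (x ⊗ y) ∘ δ ∘ w. For z =
γ(w) this is both the multiplicativity of γ and the A-linearity of μ. -/
theorem act_homTensor (b c : M ⟶ M)
    (z : (sourceTarget adj).takeuchi) (w : aL ≫ a ⟶ aL ≫ a)
    (hz : homTensor adj (aL ≫ a) (aL ≫ a) z.1 = w ≫ comul adj)
    (u : Tensor ((homFunctor adj).obj b) ((homFunctor adj).obj c)) :
    homTensor adj b c (SourceTarget.act ((preadditiveCoyonedaObj (aL ≫ a)).obj b)
      ((preadditiveCoyonedaObj (aL ≫ a)).obj c) z u) =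
      (w ≫ (show aL ≫ a ⟶ b ≫ c from homTensor adj b c u) : aL ≫ a ⟶ b ≫ c) := by
  induction u using Tensor.induction_on with
  | h0 =>
    rw [map_zero]
    refine (map_zero (homTensor adj b c)).trans ?_
    exact ((congrArg (w ≫ ·) (map_zero (homTensor adj b c))).trans Limits.comp_zero).symm
  | ht x y =>
    let f : aL ≫ a ⟶ b := x
    let h : aL ≫ a ⟶ c := y
    have := Functor.LaxMonoidal.μ_natural (homFunctor adj) f h
    refine (DFunLike.congr_fun this z.1).trans ?_
    refine (congrArg ((homFunctor adj).map (MonoidalCategory.tensorHom f h)) hz).trans ?_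
    change (w ≫ comul adj) ≫ (f ▷ (aL ≫ a) ≫ b ◁ h) = w ≫ comul adj ≫ (f ▷ (aL ≫ a) ≫ b ◁ h)
    rw [Category.assoc]
  | ha u u' h h' =>
    refine (congrArg (homTensor adj b c) (map_add _ u u')).trans ?_
    refine (map_add (homTensor adj b c) _ _).trans ((congrArg₂ (· + ·) h h').trans ?_)
    exact ((congrArg (w ≫ ·) (map_add (homTensor adj b c) u u')).trans
      (Preadditive.comp_add _ _ _ _ _ _)).symm

variable (h : FactorsThrough a (a ≫ aL ≫ a))

/-- The comultiplication of `End g`, determined by `μ (γ x) = δ ∘ x`. -/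
noncomputable def endComul : (sourceTarget adj).bimodule ⟶
    BimodCat.tensor (sourceTarget adj).bimodule (sourceTarget adj).bimodule :=
  (homFunctor adj).map (comul adj) ≫
    @inv _ _ _ _ (homTensor adj (aL ≫ a) (aL ≫ a)) (isIso_homTensor adj h (aL ≫ a))

/-- The counit of `End g`, determined by `ν (π x) = ε ∘ x`. -/
noncomputable def endCounit : (sourceTarget adj).bimodule ⟶ BimodCat.regular (End a) :=
  (homFunctor adj).map adj.counit ≫ @inv _ _ _ _ (homUnit adj) (isIso_homUnit adj)

theorem endComul_homTensor : (show (homFunctor adj).obj (aL ≫ a) ⟶ _ from endComul adj h) ≫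
    homTensor adj (aL ≫ a) (aL ≫ a) = (homFunctor adj).map (comul adj) := by
  exact (Category.assoc _ _ _).trans ((congrArg _ (@IsIso.inv_hom_id _ _ _ _ _
    (isIso_homTensor adj h (aL ≫ a)))).trans (Category.comp_id _))

theorem endCounit_homUnit : (show (homFunctor adj).obj (aL ≫ a) ⟶ _ from endCounit adj) ≫
    homUnit adj = (homFunctor adj).map adj.counit := by
  exact (Category.assoc _ _ _).trans ((congrArg _ (@IsIso.inv_hom_id _ _ _ _ _
    (isIso_homUnit adj))).trans (Category.comp_id _))

theorem homTensor_endComul (x : aL ≫ a ⟶ aL ≫ a) :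
    homTensor adj (aL ≫ a) (aL ≫ a) (endComul adj h x) = x ≫ comul adj :=
  DFunLike.congr_fun (endComul_homTensor adj h) x

theorem homUnit_endCounit (x : aL ≫ a ⟶ aL ≫ a) :
    homUnit adj (endCounit adj x) = x ≫ adj.counit :=
  DFunLike.congr_fun (endCounit_homUnit adj) x

/-- Under the injective map μ, the two multiplications become whiskered endomorphisms after δ ∘ x,
and these agree by `comul_balanced`. -/
theorem endComul_mem (x : aL ≫ a ⟶ aL ≫ a) : endComul adj h x ∈ (sourceTarget adj).takeuchi := by
  intro r
  apply (homTensor_bijective adj h (aL ≫ a)).1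
  let s : aL ≫ a ⟶ aL ≫ a := aL ◁ (show a ⟶ a from r)
  let t : aL ≫ a ⟶ aL ≫ a := leftDual adj r ▷ a
  have h₁ := Functor.LaxMonoidal.μ_natural_left (homFunctor adj) s (aL ≫ a)
  have h₂ := Functor.LaxMonoidal.μ_natural_right (homFunctor adj) (aL ≫ a) t
  refine (DFunLike.congr_fun h₁ (endComul adj h x)).trans (.trans ?_
    (DFunLike.congr_fun h₂ (endComul adj h x)).symm)
  refine (congrArg ((homFunctor adj).map (s ▷ (aL ≫ a))) (homTensor_endComul adj h x)).trans
    (.trans ?_ (congrArg ((homFunctor adj).map ((aL ≫ a) ◁ t)) (homTensor_endComul adj h x)).symm)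
  change (x ≫ comul adj) ≫ s ▷ (aL ≫ a) = (x ≫ comul adj) ≫ (aL ≫ a) ◁ t
  rw [Category.assoc, Category.assoc, comul_balanced]

/-- This is the A-linearity of ν for the action π(s(r)x) on R, because the product s(r)x in End g is
x followed by a^L r. -/
theorem endCounit_homUnit_mul (r : a ⟶ a) (x : aL ≫ a ⟶ aL ≫ a) :
    homUnit adj (endCounit adj (x ≫ aL ◁ r : aL ≫ a ⟶ aL ≫ a)) =
      (x ≫ (show aL ≫ a ⟶ 𝟙 M from homUnit adj r) : aL ≫ a ⟶ 𝟙 M) :=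
  (homUnit_endCounit adj _).trans (Category.assoc _ _ _)

/-- The bialgebroid structure on `End g`. -/
noncomputable def endBialgebroid : Bialgebroid (End a) (End (aL ≫ a)) where
  toSourceTarget := sourceTarget adj
  comul := endComul adj h
  counit := endCounit adj
  coassoc :=
    haveI : IsIso (Functor.LaxMonoidal.μ (homFunctor adj) (aL ≫ a) (aL ≫ a)) :=
      isIso_homTensor adj h (aL ≫ a)
    haveI : IsIso (Functor.LaxMonoidal.μ (homFunctor adj) (aL ≫ a)
        (MonoidalCategory.tensorObj (aL ≫ a) (aL ≫ a))) :=
      isIso_homTensor adj h _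
    coassoc_of_laxMonoidal (homFunctor adj) (comul adj) (endComul adj h)
      (endComul_homTensor adj h) (comul_assoc adj)
  counit_left := counit_left_of_laxMonoidal (homFunctor adj) (comul adj) adj.counit
    (endComul adj h) (endCounit adj) (endComul_homTensor adj h) (endCounit_homUnit adj)
    (counit_comul adj)
  counit_right := counit_right_of_laxMonoidal (homFunctor adj) (comul adj) adj.counit
    (endComul adj h) (endCounit adj) (endComul_homTensor adj h) (endCounit_homUnit adj)
    (comul_counit adj)
  comul_mem := endComul_mem adj h
  comul_mul x y := (homTensor_bijective adj h (aL ≫ a)).1 <| by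
    refine .trans ?_ (act_homTensor adj _ _ _ y (homTensor_endComul adj h y) _).symm
    refine .trans ?_ (congrArg (fun z : aL ≫ a ⟶ (aL ≫ a) ≫ aL ≫ a => y ≫ z)
      (homTensor_endComul adj h x)).symm
    exact (homTensor_endComul adj h _).trans (Category.assoc _ _ _)
  comul_one := (homTensor_bijective adj h (aL ≫ a)).1 <| by
    refine (homTensor_endComul adj h (𝟙 _)).trans (.trans ?_
      (homTensor_tmul adj _ _ (𝟙 _) (𝟙 _)).symm)
    simp only [id_whiskerRight, whiskerLeft_id, Category.id_comp, Category.comp_id]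
    rfl
  counit_one := (homUnit_bijective adj).1 <| by
    refine (homUnit_endCounit adj (𝟙 _)).trans ?_
    change _ = aL ◁ (𝟙 a) ≫ adj.counit
    simp only [whiskerLeft_id, Category.id_comp]
  counit_target_mul x y := (homUnit_bijective adj).1 <| by
    refine (homUnit_endCounit adj _).trans (.trans ?_ (homUnit_endCounit adj _).symm)
    have h₁ := homUnit_endCounit adj x
    change aL ◁ (show a ⟶ a from endCounit adj x) ≫ adj.counit = _ at h₁
    change ((y : aL ≫ a ⟶ aL ≫ a) ≫ leftDual adj (endCounit adj x) ▷ a) ≫ adj.counit =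
      ((y : aL ≫ a ⟶ aL ≫ a) ≫ x) ≫ adj.counit
    -- Followed by ε, the target map agrees with the source map, which leaves the defining equation
    -- of π(x).
    rw [Category.assoc, Category.assoc, leftDual_counit]
    exact congrArg _ h₁
  counit_source_mul x y := (homUnit_bijective adj).1 <| by
    refine (homUnit_endCounit adj _).trans (.trans ?_ (homUnit_endCounit adj _).symm)
    have h₁ := homUnit_endCounit adj x
    change aL ◁ (show a ⟶ a from endCounit adj x) ≫ adj.counit = _ at h₁
    change ((y : aL ≫ a ⟶ aL ≫ a) ≫ aL ◁ (show a ⟶ a from endCounit adj x)) ≫ adj.counit =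
      ((y : aL ≫ a ⟶ aL ≫ a) ≫ x) ≫ adj.counit
    rw [Category.assoc, Category.assoc]
    exact congrArg _ h₁

end DepthTwo

/-! ### Summands of multiples of g and finitely generated projective modules over End g. -/

section PreadditiveCoyoneda

variable {D : Type u} [Category.{v} D] [Preadditive D] (g : D)

theorem preadditiveCoyonedaObj_map_injective {b c : D} (h : FactorsThrough g b) :
    Function.Injective ((preadditiveCoyonedaObj g).map : (b ⟶ c) → _) := by
  intro f f' e
  obtain ⟨n, i, p, e'⟩ := h
  have h₁ : ∀ x : g ⟶ b, x ≫ f = x ≫ f' := fun x => congrArg (fun t => t.hom x) e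
  rw [← Category.id_comp f, ← Category.id_comp f', ← e', Preadditive.sum_comp,
    Preadditive.sum_comp]
  simp [h₁]

/-- Any x : g → b equals ∑ (x ≫ i k) ≫ p k, so a linear map f is determined by its values at the p
k, and ∑ i k ≫ f(p k) induces it. -/
theorem preadditiveCoyonedaObj_map_surjective {b c : D} (h : FactorsThrough g b) :
    Function.Surjective ((preadditiveCoyonedaObj g).map : (b ⟶ c) → _) := by
  intro f
  obtain ⟨n, i, p, e⟩ := h
  refine ⟨∑ k, i k ≫ (show g ⟶ c from f.hom (p k)), ?_⟩
  ext (x : g ⟶ b)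
  have h₁ : ∀ (y : g ⟶ g) (z : g ⟶ b), y ≫ (show g ⟶ c from f.hom z) = f.hom (y ≫ z) :=
    fun y z => (f.hom.map_smul (MulOpposite.op (show End g from y)) z).symm
  change x ≫ _ = f.hom x
  rw [Preadditive.comp_sum]
  refine (Finset.sum_congr rfl fun k _ =>
    (Category.assoc x (i k) _).symm.trans (h₁ (x ≫ i k) (p k))).trans ?_
  refine (map_sum f.hom _ _).symm.trans (congrArg _ ?_)
  simp only [Category.assoc]
  exact (Preadditive.comp_sum _ _ _).symm.trans ((congrArg (x ≫ ·) e).trans (Category.comp_id x))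

/-- Composition with the i k and with the p k makes Hom(g, b) a retract of a free module of rank n.
-/
theorem preadditiveCoyonedaObj_fgp {b : D} (h : FactorsThrough g b) :
    Module.Finite (End g)ᵐᵒᵖ ((preadditiveCoyonedaObj g).obj b) ∧
      Module.Projective (End g)ᵐᵒᵖ ((preadditiveCoyonedaObj g).obj b) := by
  obtain ⟨n, i, p, e⟩ := h
  let s : (preadditiveCoyonedaObj g).obj b →ₗ[(End g)ᵐᵒᵖ] (Fin n → (End g)ᵐᵒᵖ) :=
    LinearMap.pi fun k =>
      { toFun := fun x : g ⟶ b => MulOpposite.op (show End g from x ≫ i k)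
        map_add' := fun x y => congrArg MulOpposite.op (Preadditive.add_comp _ _ _ x y (i k))
        map_smul' := fun r x => congrArg MulOpposite.op (Category.assoc _ _ _) }
  let q : (Fin n → (End g)ᵐᵒᵖ) →ₗ[(End g)ᵐᵒᵖ] (preadditiveCoyonedaObj g).obj b :=
    Fintype.linearCombination (M := (preadditiveCoyonedaObj g).obj b) (End g)ᵐᵒᵖ p
  have hq : q.comp s = LinearMap.id := by
    ext (x : g ⟶ b)
    change ∑ k, (x ≫ i k) ≫ p k = x
    simp only [Category.assoc]
    rw [← Preadditive.comp_sum, e, Category.comp_id]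
  exact ⟨Module.Finite.of_surjective q (LinearMap.surjective_of_comp_eq_id _ _ hq),
    Module.Projective.of_split s q hq⟩

/-- The module V is cut out by an idempotent of Hom(g, gⁿ). Full faithfulness lifts it to an
idempotent of gⁿ, and a splitting of the latter represents V. -/
theorem exists_iso_preadditiveCoyonedaObj [Limits.HasFiniteBiproducts D]
    [IsIdempotentComplete D] (V : ModuleCat.{v} (End g)ᵐᵒᵖ) (hf : Module.Finite (End g)ᵐᵒᵖ V)
    (hp : Module.Projective (End g)ᵐᵒᵖ V) :
    ∃ b, FactorsThrough g b ∧ Nonempty ((preadditiveCoyonedaObj g).obj b ≅ V) := by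
  obtain ⟨n, q, hq⟩ := Module.Finite.exists_fin' (End g)ᵐᵒᵖ V
  obtain ⟨s, hs⟩ := Module.projective_lifting_property q LinearMap.id hq
  let G := preadditiveCoyonedaObj g
  let X : D := Limits.biproduct fun _ : Fin n => g
  let π := Limits.biproduct.π fun _ : Fin n => g
  let ι := Limits.biproduct.ι fun _ : Fin n => g
  have hX : FactorsThrough g X := ⟨n, π, ι, Limits.biproduct.total⟩
  let t : G.obj X →ₗ[(End g)ᵐᵒᵖ] (Fin n → (End g)ᵐᵒᵖ) :=
    LinearMap.pi fun k =>
      { toFun := fun x : g ⟶ X => MulOpposite.op (show End g from x ≫ π k)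
        map_add' := fun x y => congrArg MulOpposite.op (Preadditive.add_comp _ _ _ x y (π k))
        map_smul' := fun r x => congrArg MulOpposite.op (Category.assoc _ _ _) }
  let t' : (Fin n → (End g)ᵐᵒᵖ) →ₗ[(End g)ᵐᵒᵖ] G.obj X :=
    Fintype.linearCombination (M := G.obj X) (End g)ᵐᵒᵖ ι
  -- This one composite suffices to make V a retract of G(X).
  have ht : t.comp t' = LinearMap.id := by
    refine LinearMap.ext fun x => funext fun k => congrArg MulOpposite.op ?_
    change (∑ l, (show g ⟶ g from (x l).unop) ≫ ι l) ≫ π k = (x k).unop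
    simp only [Preadditive.sum_comp, Category.assoc]
    rw [Finset.sum_eq_single k]
    · simp [π, ι]
    · intro l _ hl
      simp [π, ι, Limits.biproduct.ι_π_ne _ hl]
    · simp
  let j : V ⟶ G.obj X := ModuleCat.ofHom (t'.comp s)
  let r : G.obj X ⟶ V := ModuleCat.ofHom (q.comp t)
  have hjr : j ≫ r = 𝟙 V := by
    ext x
    change q (t (t' (s x))) = x
    rw [show t (t' (s x)) = s x from LinearMap.congr_fun ht _]
    exact LinearMap.congr_fun hs x
  obtain ⟨f, hf⟩ := preadditiveCoyonedaObj_map_surjective g hX (r ≫ j)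
  have hff : f ≫ f = f := preadditiveCoyonedaObj_map_injective g hX (by
    rw [Functor.map_comp, hf]
    simp [reassoc_of% hjr])
  obtain ⟨b, i, p, hip, hpi⟩ := IsIdempotentComplete.idempotents_split X f hff
  have h₁ : G.map i ≫ G.map p = 𝟙 _ := by rw [← G.map_comp, hip, G.map_id]
  have h₂ : G.map p ≫ G.map i = r ≫ j := by rw [← G.map_comp, hpi]; exact hf
  -- G(b) and V split the same idempotent `r ≫ j` of G(X), hence are isomorphic.
  refine ⟨b, hX.trans (.of_retract ⟨i, p, hip⟩), ⟨⟨G.map i ≫ r, j ≫ G.map p, ?_, ?_⟩⟩⟩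
  · rw [Category.assoc, ← reassoc_of% h₂, h₁, Category.comp_id, h₁]
  · rw [Category.assoc, reassoc_of% h₂, hjr, Category.comp_id, hjr]

end PreadditiveCoyoneda

/-! ### Lifting lax monoidal structures along a faithful strong monoidal functor. -/

section

open MonoidalCategory Functor.LaxMonoidal

variable {C D E : Type*} [Category C] [Category D] [Category E] [MonoidalCategory C]
  [MonoidalCategory D] [MonoidalCategory E]

/-- A lax monoidal structure on a functor `H` whose composite with a faithful strong monoidal
functor `U` is isomorphic to a lax monoidal functor `F`, when the structure maps of `F` lift
along `U`. -/
@[reducible]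
def laxMonoidalOfFaithful (H : C ⥤ D) (U : D ⥤ E) [U.Monoidal] [U.Faithful] (F : C ⥤ E)
    [F.LaxMonoidal] (e : H ⋙ U ≅ F) (ε' : 𝟙_ D ⟶ H.obj (𝟙_ C))
    (μ' : ∀ X Y, H.obj X ⊗ H.obj Y ⟶ H.obj (X ⊗ Y))
    (hε : ε U ≫ U.map ε' ≫ e.hom.app (𝟙_ C) = ε F)
    (hμ : ∀ X Y, μ U (H.obj X) (H.obj Y) ≫ U.map (μ' X Y) ≫ e.hom.app (X ⊗ Y) =
      (e.hom.app X ⊗ₘ e.hom.app Y) ≫ μ F X Y) : H.LaxMonoidal where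
  ε := ε'
  μ := μ'
  -- Every axiom is checked after U. Cancelling the structure isomorphisms of U on the left and a
  -- component of e on the right reduces it to the same axiom for F.
  μ_natural_left {X Y} f Z := U.map_injective <| by
    have n := e.hom.naturality (f ▷ Z)
    have n' := e.hom.naturality f
    dsimp only [Functor.comp_obj, Functor.comp_map] at n n' hμ
    rw [← cancel_mono (e.hom.app (Y ⊗ Z)), ← cancel_epi (μ U (H.obj X) (H.obj Z))]
    simp only [U.map_comp, Category.assoc]
    rw [← μ_natural_left_assoc, n, hμ, reassoc_of% hμ X Z, ← μ_natural_left, ← tensorHom_id,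
      ← tensorHom_id, tensorHom_comp_tensorHom_assoc, tensorHom_comp_tensorHom_assoc, n']
    simp
  μ_natural_right {X Y} Z f := U.map_injective <| by
    have n := e.hom.naturality (Z ◁ f)
    have n' := e.hom.naturality f
    dsimp only [Functor.comp_obj, Functor.comp_map] at n n' hμ
    rw [← cancel_mono (e.hom.app (Z ⊗ Y)), ← cancel_epi (μ U (H.obj Z) (H.obj X))]
    simp only [U.map_comp, Category.assoc]
    rw [← μ_natural_right_assoc, n, hμ, reassoc_of% hμ Z X, ← μ_natural_right, ← id_tensorHom,
      ← id_tensorHom, tensorHom_comp_tensorHom_assoc, tensorHom_comp_tensorHom_assoc, n']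
    simp
  associativity X Y Z := U.map_injective <| by
    have n := e.hom.naturality (α_ X Y Z).hom
    dsimp only [Functor.comp_obj, Functor.comp_map] at n hμ
    have hl : μ U (H.obj X) (H.obj Y) ▷ U.obj (H.obj Z) ≫ U.map (μ' X Y) ▷ U.obj (H.obj Z) ≫
        (e.hom.app (X ⊗ Y) ⊗ₘ e.hom.app Z) =
        ((e.hom.app X ⊗ₘ e.hom.app Y) ⊗ₘ e.hom.app Z) ≫ μ F X Y ▷ F.obj Z := by
      simp only [← tensorHom_id, tensorHom_comp_tensorHom, Category.id_comp, Category.comp_id, hμ]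
    have hr : U.obj (H.obj X) ◁ μ U (H.obj Y) (H.obj Z) ≫ U.obj (H.obj X) ◁ U.map (μ' Y Z) ≫
        (e.hom.app X ⊗ₘ e.hom.app (Y ⊗ Z)) =
        (e.hom.app X ⊗ₘ (e.hom.app Y ⊗ₘ e.hom.app Z)) ≫ F.obj X ◁ μ F Y Z := by
      simp only [← id_tensorHom, tensorHom_comp_tensorHom, Category.id_comp, Category.comp_id, hμ]
    rw [← cancel_mono (e.hom.app (X ⊗ Y ⊗ Z)), ← cancel_epi (μ U (H.obj X ⊗ H.obj Y) (H.obj Z)),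
      ← cancel_epi (μ U (H.obj X) (H.obj Y) ▷ U.obj (H.obj Z))]
    simp only [U.map_comp, Category.assoc]
    rw [← μ_natural_left_assoc, n, reassoc_of% hμ (X ⊗ Y) Z, reassoc_of% hl, associativity,
      associativity_assoc, ← μ_natural_right_assoc, hμ, reassoc_of% hr,
      associator_naturality_assoc]
  left_unitality X := U.map_injective <| by
    have n := e.hom.naturality (λ_ X).hom
    dsimp only [Functor.comp_obj, Functor.comp_map] at n hμ
    have hl : ε U ▷ U.obj (H.obj X) ≫ U.map ε' ▷ U.obj (H.obj X) ≫
        (e.hom.app (𝟙_ C) ⊗ₘ e.hom.app X) = 𝟙_ E ◁ e.hom.app X ≫ ε F ▷ F.obj X := by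
      simp only [← tensorHom_id, ← id_tensorHom, tensorHom_comp_tensorHom, Category.id_comp,
        Category.comp_id, hε]
    rw [← cancel_mono (e.hom.app X), ← cancel_epi (μ U (𝟙_ D) (H.obj X)),
      ← cancel_epi (ε U ▷ U.obj (H.obj X))]
    simp only [U.map_comp, Category.assoc]
    rw [← μ_natural_left_assoc, n, reassoc_of% hμ (𝟙_ C) X, reassoc_of% hl,
      ← left_unitality, ← left_unitality_assoc U, leftUnitor_naturality]
  right_unitality X := U.map_injective <| by
    have n := e.hom.naturality (ρ_ X).hom
    dsimp only [Functor.comp_obj, Functor.comp_map] at n hμ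
    have hr : U.obj (H.obj X) ◁ ε U ≫ U.obj (H.obj X) ◁ U.map ε' ≫
        (e.hom.app X ⊗ₘ e.hom.app (𝟙_ C)) = e.hom.app X ▷ 𝟙_ E ≫ F.obj X ◁ ε F := by
      simp only [← tensorHom_id, ← id_tensorHom, tensorHom_comp_tensorHom, Category.id_comp,
        Category.comp_id, hε]
    rw [← cancel_mono (e.hom.app X), ← cancel_epi (μ U (H.obj X) (𝟙_ D)),
      ← cancel_epi (U.obj (H.obj X) ◁ ε U)]
    simp only [U.map_comp, Category.assoc]
    rw [← μ_natural_right_assoc, n, reassoc_of% hμ X (𝟙_ C), reassoc_of% hr,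
      ← right_unitality, ← right_unitality_assoc U, rightUnitor_naturality]

theorem isMonoidal_laxMonoidalOfFaithful (H : C ⥤ D) (U : D ⥤ E) [U.Monoidal] [U.Faithful]
    (F : C ⥤ E) [F.LaxMonoidal] (e : H ⋙ U ≅ F) (ε' : 𝟙_ D ⟶ H.obj (𝟙_ C))
    (μ' : ∀ X Y, H.obj X ⊗ H.obj Y ⟶ H.obj (X ⊗ Y))
    (hε : ε U ≫ U.map ε' ≫ e.hom.app (𝟙_ C) = ε F)
    (hμ : ∀ X Y, μ U (H.obj X) (H.obj Y) ≫ U.map (μ' X Y) ≫ e.hom.app (X ⊗ Y) =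
      (e.hom.app X ⊗ₘ e.hom.app Y) ≫ μ F X Y) :
    letI := laxMonoidalOfFaithful H U F e ε' μ' hε hμ
    NatTrans.IsMonoidal e.hom :=
  letI := laxMonoidalOfFaithful H U F e ε' μ' hε hμ
  { unit := (Category.assoc _ _ _).trans hε
    tensor := fun X Y => (Category.assoc _ _ _).trans (hμ X Y) }

end

/-! ### The A-linear structure maps, and closure of C_g under composition. -/

namespace DepthTwo

open Bicategory MulOpposite BimodCat BimodCat.Tensor

variable {C : Type u} [Bicategory.{w, v} C] [PreadditiveBicategory C] {N M : C}
  {a : N ⟶ M} {aL : M ⟶ N} (adj : Bicategory.Adjunction a aL)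
  (h : FactorsThrough a (a ≫ aL ≫ a))

/-- The `A`-linear morphism underlain by `homUnit`. -/
noncomputable def homModUnit : (endBialgebroid adj h).tensorUnit ⟶
    (preadditiveCoyonedaObj (aL ≫ a)).obj (𝟙 M) :=
  Bialgebroid.homOf ((endBialgebroid adj h).epsIso.inv ≫ homUnit adj)
    fun r => hom_ext fun x => endCounit_homUnit_mul adj r x

/-- The `A`-linear morphism underlain by `homTensor`. -/
noncomputable def homModTensor (b c : M ⟶ M) :
    (endBialgebroid adj h).tensorObj ((preadditiveCoyonedaObj (aL ≫ a)).obj b)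
        ((preadditiveCoyonedaObj (aL ≫ a)).obj c) ⟶
      (preadditiveCoyonedaObj (aL ≫ a)).obj (b ≫ c) :=
  Bialgebroid.homOf (((endBialgebroid adj h).muIso _ _).inv ≫ homTensor adj b c)
    fun u => hom_ext fun x => act_homTensor adj b c ((endBialgebroid adj h).comulT x) x
      (homTensor_endComul adj h x) u

/-- Whiskering shows that a b factors through a g, and depth two takes a g to a. This is the
condition needed to invert μ_{b,c}. -/
theorem factorsThrough_comp (h : FactorsThrough a (a ≫ aL ≫ a)) {b : M ⟶ M} (hb : FactorsThrough (aL ≫ a) b) :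
    FactorsThrough a (a ≫ b) :=
  haveI := precomp_additive (L := M) a
  h.trans (hb.map (precomp M a))

/-- The chain is b c through b g, through g g, through g. The last link is depth two whiskered by
a^L on the left. -/
theorem factorsThrough_tensor (h : FactorsThrough a (a ≫ aL ≫ a)) {b c : M ⟶ M}
    (hb : FactorsThrough (aL ≫ a) b)
    (hc : FactorsThrough (aL ≫ a) c) : FactorsThrough (aL ≫ a) (b ≫ c) := by
  have := precomp_additive (L := M) b
  have := precomp_additive (L := M) aL
  have := postcomp_additive (L := M) a
  have h₁ : FactorsThrough (b ≫ aL ≫ a) (b ≫ c) := hc.map (precomp M b)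
  have := postcomp_additive (L := M) (aL ≫ a)
  have h₂ : FactorsThrough ((aL ≫ a) ≫ aL ≫ a) (b ≫ aL ≫ a) := hb.map (postcomp M (aL ≫ a))
  have h₃ : FactorsThrough (aL ≫ a) (aL ≫ a ≫ aL ≫ a) := h.map (precomp M aL)
  exact ((h₃.trans (.of_retract (.ofIso (α_ aL a (aL ≫ a))))).trans h₂).trans h₁

/-- For `b` in `C_g`, the morphism `homModTensor` is invertible. -/
noncomputable def homModTensorIso {b : M ⟶ M} (hb : FactorsThrough (aL ≫ a) b) (c : M ⟶ M) :
    (endBialgebroid adj h).tensorObj ((preadditiveCoyonedaObj (aL ≫ a)).obj b)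
        ((preadditiveCoyonedaObj (aL ≫ a)).obj c) ≅
      (preadditiveCoyonedaObj (aL ≫ a)).obj (b ≫ c) :=
  Bialgebroid.isoOf (((endBialgebroid adj h).muIso _ _).symm ≪≫
      @asIso _ _ _ _ (homTensor adj b c) (isIso_homTensor adj (factorsThrough_comp h hb) c))
    fun u => hom_ext fun x => act_homTensor adj b c ((endBialgebroid adj h).comulT x) x
      (homTensor_endComul adj h x) u

/-- The morphism `homModUnit` is invertible. -/
noncomputable def homModUnitIso : (endBialgebroid adj h).tensorUnit ≅
    (preadditiveCoyonedaObj (aL ≫ a)).obj (𝟙 M) :=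
  Bialgebroid.isoOf ((endBialgebroid adj h).epsIso.symm ≪≫
      @asIso _ _ _ _ (homUnit adj) (isIso_homUnit adj))
    fun r => hom_ext fun x => endCounit_homUnit_mul adj r x

theorem fgp_of_iso {R A : Type u} [Ring R] [Ring A] (B : Bialgebroid R A)
    {V W : ModuleCat.{u} Aᵐᵒᵖ} (i : V ≅ W) (hV : B.fgp V) : B.fgp W :=
  ⟨have := hV.1; .equiv i.toLinearEquiv, have := hV.2; .of_equiv i.toLinearEquiv⟩

end DepthTwo

/-! ### The strong monoidal equivalence between C_g and the finitely generated projective modules.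
-/

namespace DepthTwo

variable {C : Type u} [Bicategory.{w, v} C] [PreadditiveBicategory C]
    [∀ M N : C, Limits.HasFiniteBiproducts (M ⟶ N)] {N M : C}
  {a : N ⟶ M} {aL : M ⟶ N} (adj : Bicategory.Adjunction a aL)
  (h : FactorsThrough a (a ≫ aL ≫ a))

open MonoidalCategory

/-- Every finitely generated projective module is some G(b), and G(b) ⊗ G(c) ≅ G(b c) with b c again
in C_g; the unit is G(1_M). -/
theorem fgp_isMonoidal [IsIdempotentComplete (M ⟶ M)]
    (h₁ : FactorsThrough (aL ≫ a) (𝟙 M)) : (endBialgebroid adj h).fgp.IsMonoidal where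
  prop_unit := fgp_of_iso _ (homModUnitIso adj h).symm (preadditiveCoyonedaObj_fgp _ h₁)
  prop_tensor V W hV hW := by
    obtain ⟨b, hb, ⟨i⟩⟩ := exists_iso_preadditiveCoyonedaObj (aL ≫ a) V hV.1 hV.2
    obtain ⟨c, hc, ⟨j⟩⟩ := exists_iso_preadditiveCoyonedaObj (aL ≫ a) W hW.1 hW.2
    -- The isomorphisms are reread in `B.Mod`, where the tensor product ⊗ᵢ is that of the
    -- bialgebroid.
    let i' : (homMod (endBialgebroid adj h)).obj b ≅ V := ⟨i.hom, i.inv, i.3, i.4⟩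
    let j' : (homMod (endBialgebroid adj h)).obj c ≅ W := ⟨j.hom, j.inv, j.3, j.4⟩
    let k : (preadditiveCoyonedaObj (aL ≫ a)).obj (b ≫ c) ≅
        (endBialgebroid adj h).tensorObj V W :=
      (homModTensorIso adj h hb c).symm.trans
        ⟨(i' ⊗ᵢ j').hom, (i' ⊗ᵢ j').inv, (i' ⊗ᵢ j').hom_inv_id, (i' ⊗ᵢ j').inv_hom_id⟩
    exact fgp_of_iso _ k (preadditiveCoyonedaObj_fgp _ (factorsThrough_tensor h hb hc))

theorem cg_isMonoidal (h : FactorsThrough a (a ≫ aL ≫ a))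
    (h₁ : FactorsThrough (aL ≫ a) (𝟙 M)) : (Cg adj).IsMonoidal where
  prop_unit := summandOfMultiple_iff.2 h₁
  prop_tensor _ _ hb hc := summandOfMultiple_iff.2
    (factorsThrough_tensor h (summandOfMultiple_iff.1 hb) (summandOfMultiple_iff.1 hc))

/-- The functor `Hom(g, _)` from `C_g` to finitely generated projective modules. -/
abbrev homFgp (B : Bialgebroid (End a) (End (aL ≫ a)))
    (mem : ∀ b, B.fgp (((Cg adj).ι ⋙ homMod B).obj b)) :
    (Cg adj).FullSubcategory ⥤ B.fgp.FullSubcategory :=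
  B.fgp.lift ((Cg adj).ι ⋙ homMod B) mem

theorem homFgp_mem (B : Bialgebroid (End a) (End (aL ≫ a))) (b : (Cg adj).FullSubcategory) :
    B.fgp (((Cg adj).ι ⋙ homMod B).obj b) :=
  preadditiveCoyonedaObj_fgp _ (summandOfMultiple_iff.1 b.2)

/-- As a plain category, `B.Mod` is the category of right A-modules whatever B is, so this is the
projectivization argument. -/
theorem homFgp_isEquivalence [IsIdempotentComplete (M ⟶ M)]
    (B : Bialgebroid (End a) (End (aL ≫ a)))
    (mem : ∀ b, B.fgp (((Cg adj).ι ⋙ homMod B).obj b)) : (homFgp adj B mem).IsEquivalence where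
  faithful := ⟨fun {b _ f f'} e => InducedCategory.hom_ext
    (preadditiveCoyonedaObj_map_injective _ (summandOfMultiple_iff.1 b.2)
      (congrArg (fun t => t.hom) e))⟩
  full := ⟨fun {b c} f => by
    obtain ⟨x, hx⟩ := preadditiveCoyonedaObj_map_surjective (aL ≫ a)
      (summandOfMultiple_iff.1 b.2) (c := c.obj) f.hom
    exact ⟨ObjectProperty.homMk x, InducedCategory.hom_ext hx⟩⟩
  essSurj := ⟨fun V => by
    obtain ⟨b, hb, ⟨i⟩⟩ := exists_iso_preadditiveCoyonedaObj (aL ≫ a) V.obj V.2.1 V.2.2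
    exact ⟨⟨b, summandOfMultiple_iff.2 hb⟩, ⟨B.fgp.isoMk ⟨i.hom, i.inv, i.3, i.4⟩⟩⟩⟩

/-- The identity isomorphism between the underlying bimodules of `homFgp` and `homFunctor`. -/
noncomputable def homFgpIso :
    homFgp adj (endBialgebroid adj h) (homFgp_mem adj _) ⋙
      (endBialgebroid adj h).fgp.ι ⋙ (endBialgebroid adj h).forget ≅
    (Cg adj).ι ⋙ homFunctor adj := Iso.refl _

variable [(Cg adj).IsMonoidal]

theorem ι_homFunctor_μ (b c : (Cg adj).FullSubcategory) :
    Functor.LaxMonoidal.μ ((Cg adj).ι ⋙ homFunctor adj) b c = homTensor adj b.obj c.obj := by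
  rw [Functor.LaxMonoidal.comp_μ, ObjectProperty.ι_μ, CategoryTheory.Functor.map_id]
  exact Category.comp_id _

theorem ι_homFunctor_ε :
    Functor.LaxMonoidal.ε ((Cg adj).ι ⋙ homFunctor adj) = homUnit adj := by
  rw [Functor.LaxMonoidal.comp_ε, ObjectProperty.ι_ε, CategoryTheory.Functor.map_id]
  exact Category.comp_id _

variable [(endBialgebroid adj h).fgp.IsMonoidal]

/-- The structure maps of the forgetful functor and the components of `homFgpIso` are identities on
elements, so only ν is left; in `homFgp_μ_comp`, only μ. -/
theorem homFgp_ε_comp :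
    Functor.LaxMonoidal.ε ((endBialgebroid adj h).fgp.ι ⋙ (endBialgebroid adj h).forget) ≫
      ((endBialgebroid adj h).fgp.ι ⋙ (endBialgebroid adj h).forget).map
        (Y := (homFgp adj _ (homFgp_mem adj _)).obj (𝟙_ _))
        (ObjectProperty.homMk (homModUnit adj h)) ≫ (homFgpIso adj h).hom.app (𝟙_ _) =
      Functor.LaxMonoidal.ε ((Cg adj).ι ⋙ homFunctor adj) :=
  (BimodCat.hom_ext fun _ => rfl).trans (ι_homFunctor_ε adj).symm

theorem homFgp_μ_comp (b c : (Cg adj).FullSubcategory) :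
    Functor.LaxMonoidal.μ ((endBialgebroid adj h).fgp.ι ⋙ (endBialgebroid adj h).forget)
        ((homFgp adj _ (homFgp_mem adj _)).obj b) ((homFgp adj _ (homFgp_mem adj _)).obj c) ≫
      ((endBialgebroid adj h).fgp.ι ⋙ (endBialgebroid adj h).forget).map
        (Y := (homFgp adj _ (homFgp_mem adj _)).obj (b ⊗ c))
        (ObjectProperty.homMk (homModTensor adj h b.obj c.obj)) ≫
          (homFgpIso adj h).hom.app (b ⊗ c) =
      ((homFgpIso adj h).hom.app b ⊗ₘ (homFgpIso adj h).hom.app c) ≫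
        Functor.LaxMonoidal.μ ((Cg adj).ι ⋙ homFunctor adj) b c := by
  rw [ι_homFunctor_μ]
  exact BimodCat.tensor_hom_ext fun x y => rfl

/-- The lax monoidal structure on `homFgp`. -/
@[reducible]
noncomputable def homFgpLaxMonoidal :
    (homFgp adj (endBialgebroid adj h) (homFgp_mem adj _)).LaxMonoidal :=
  laxMonoidalOfFaithful _ ((endBialgebroid adj h).fgp.ι ⋙ (endBialgebroid adj h).forget)
    ((Cg adj).ι ⋙ homFunctor adj) (homFgpIso adj h) _ _ (homFgp_ε_comp adj h) (homFgp_μ_comp adj h)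

/-- The strong monoidal structure on `homFgp`. -/
@[reducible]
noncomputable def homFgpMonoidal :
    (homFgp adj (endBialgebroid adj h) (homFgp_mem adj _)).Monoidal :=
  letI := homFgpLaxMonoidal adj h
  -- The lax structure map has the same underlying map as `homModUnitIso`, and is therefore
  -- invertible; the tensor case uses `homModTensorIso`.
  haveI : IsIso (Functor.LaxMonoidal.ε
      (homFgp adj (endBialgebroid adj h) (homFgp_mem adj _))) :=
    ((endBialgebroid adj h).fgp.isoMk (X := 𝟙_ _) (Y := ⟨_, homFgp_mem adj _ (𝟙_ _)⟩)
      ⟨(homModUnitIso adj h).hom, (homModUnitIso adj h).inv,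
        (homModUnitIso adj h).3, (homModUnitIso adj h).4⟩).isIso_hom
  haveI : ∀ b c, IsIso (Functor.LaxMonoidal.μ
      (homFgp adj (endBialgebroid adj h) (homFgp_mem adj _)) b c) := fun b c =>
    let i := homModTensorIso adj h (summandOfMultiple_iff.1 b.2) c.obj
    ((endBialgebroid adj h).fgp.isoMk (X := (homFgp adj _ (homFgp_mem adj _)).obj b ⊗
      (homFgp adj _ (homFgp_mem adj _)).obj c) (Y := (homFgp adj _ (homFgp_mem adj _)).obj (b ⊗ c))
      ⟨i.hom, i.inv, i.3, i.4⟩).isIso_hom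
  Functor.Monoidal.ofLaxMonoidal _

theorem homFgpIso_isMonoidal :
    letI := homFgpMonoidal adj h
    NatTrans.IsMonoidal (homFgpIso adj h).hom :=
  isMonoidal_laxMonoidalOfFaithful _ _ _ _ _ _ (homFgp_ε_comp adj h) (homFgp_μ_comp adj h)

end DepthTwo

/-! ### Uniqueness of the bialgebroid structure. -/

namespace DepthTwo

open Bicategory MulOpposite BimodCat BimodCat.Tensor

variable {C : Type u} [Bicategory.{w, v} C] [PreadditiveBicategory C] {N M : C}
  {a : N ⟶ M} {aL : M ⟶ N} (adj : Bicategory.Adjunction a aL)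
  (h : FactorsThrough a (a ≫ aL ≫ a))

/-- A bialgebroid structure on `End g` is `endBialgebroid` as soon as its source and target maps
are the expected ones, and its comultiplication and counit correspond to `δ` and `ε`. -/
theorem eq_endBialgebroid (B : Bialgebroid (End a) (End (aL ≫ a)))
    (hs : ∀ r : a ⟶ a, B.source r = (aL ◁ r : aL ≫ a ⟶ aL ≫ a))
    (ht : ∀ r : a ⟶ a, B.target (op (show End a from r)) =
      (leftDual adj r ▷ a : aL ≫ a ⟶ aL ≫ a))
    (hγ : ∀ f : Tensor B.bimodule B.bimodule →+ (aL ≫ a ⟶ (aL ≫ a) ≫ aL ≫ a),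
      (∀ x y : aL ≫ a ⟶ aL ≫ a, f (tmul (X := B.bimodule) (Y := B.bimodule) x y) =
        comul adj ≫ x ▷ (aL ≫ a) ≫ (aL ≫ a) ◁ y) →
      ∀ w : aL ≫ a ⟶ aL ≫ a, f (B.comul w) = w ≫ comul adj)
    (hπ : ∀ w : aL ≫ a ⟶ aL ≫ a,
      aL ◁ (show a ⟶ a from B.counit w) ≫ adj.counit = w ≫ adj.counit) :
    B = endBialgebroid adj h := by
  -- The types of γ and π depend on S. Once S is replaced by `sourceTarget adj` they can be compared
  -- directly, and `homTensor` becomes an admissible f in `hγ`.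
  obtain ⟨S, γ, π, h₁, h₂, h₃, h₄, h₅, h₆, h₇, h₈, h₉⟩ := B
  obtain rfl : S = sourceTarget adj :=
    SourceTarget.ext (RingHom.ext hs) (RingHom.ext fun r => ht r.unop)
  refine Bialgebroid.ext rfl rfl (heq_of_eq (hom_ext fun w => ?_)) (heq_of_eq (hom_ext fun w => ?_))
  · exact (homTensor_bijective adj h (aL ≫ a)).1
      ((hγ (homTensor adj (aL ≫ a) (aL ≫ a)).toAddHom (fun x y => rfl) w).trans
        (homTensor_endComul adj h w).symm)
  · exact (homUnit_bijective adj).1 ((hπ w).trans (homUnit_endCounit adj w).symm)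

/-- The comultiplication is thus recovered from the module structure of A ⊗_R A, which A-linear maps
see. -/
theorem smul_one_tmul_one {R A : Type u} [Ring R] [Ring A] (B : Bialgebroid R A) (w : A) :
    (op w • (show B.tensorObj (ModuleCat.of Aᵐᵒᵖ A) (ModuleCat.of Aᵐᵒᵖ A) from
      tmul (X := B.bimodule) (Y := B.bimodule) (1 : A) (1 : A)) :
        B.tensorObj (ModuleCat.of Aᵐᵒᵖ A) (ModuleCat.of Aᵐᵒᵖ A)) = B.comul w := by
  have h₁ : B.orbit (V := ModuleCat.of Aᵐᵒᵖ A) (1 : A) = 𝟙 B.bimodule :=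
    hom_ext fun x => one_mul (show A from x)
  change tensorMap (B.orbit (V := ModuleCat.of Aᵐᵒᵖ A) (1 : A))
    (B.orbit (V := ModuleCat.of Aᵐᵒᵖ A) (1 : A)) (B.comul w) = B.comul w
  rw [h₁]
  exact DFunLike.congr_fun (MonoidalCategory.id_tensorHom_id B.bimodule B.bimodule) _

theorem smul_one_tensorUnit {R A : Type u} [Ring R] [Ring A] (B : Bialgebroid R A) (w : A) :
    (op w • (show B.tensorUnit from (1 : R)) : B.tensorUnit) = B.counit w := by
  change B.counit (B.source 1 * w : A) = _
  rw [map_one, one_mul]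

end DepthTwo

namespace DepthTwo

variable {C : Type u} [Bicategory.{w, v} C] [PreadditiveBicategory C]
    [∀ M N : C, Limits.HasFiniteBiproducts (M ⟶ N)] {N M : C}
  {a : N ⟶ M} {aL : M ⟶ N} (adj : Bicategory.Adjunction a aL)
  (h : FactorsThrough a (a ≫ aL ≫ a))

open MonoidalCategory

/-- Since e is monoidal and the identity on elements, the structure maps of G have underlying maps μ
and ν. They are also A-linear, and evaluating at units gives the hypotheses of `eq_endBialgebroid`.
-/
theorem eq_endBialgebroid_of_isMonoidal [(Cg adj).IsMonoidal]
    (B : Bialgebroid (End a) (End (aL ≫ a))) [B.fgp.IsMonoidal]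
    (mem : ∀ b, B.fgp (((Cg adj).ι ⋙ homMod B).obj b)) [(homFgp adj B mem).Monoidal]
    (e : homFgp adj B mem ⋙ B.fgp.ι ⋙ B.forget ≅ (Cg adj).ι ⋙ homFunctor adj)
    (he : ∀ (b : (Cg adj).FullSubcategory) (x : aL ≫ a ⟶ b.obj), e.hom.app b x = x)
    [NatTrans.IsMonoidal e.hom] : B = endBialgebroid adj h := by
  let g : (Cg adj).FullSubcategory := ⟨aL ≫ a, summandOfMultiple_iff.2 (.self _)⟩
  let G := preadditiveCoyonedaObj (aL ≫ a)
  let μ' : B.tensorObj (G.obj (aL ≫ a)) (G.obj (aL ≫ a)) ⟶ G.obj ((aL ≫ a) ≫ aL ≫ a) :=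
    (Functor.LaxMonoidal.μ (homFgp adj B mem) g g).hom
  let ε' : B.tensorUnit ⟶ G.obj (𝟙 M) := (Functor.LaxMonoidal.ε (homFgp adj B mem)).hom
  have hμ : ∀ x y : aL ≫ a ⟶ aL ≫ a,
      μ'.hom (BimodCat.Tensor.tmul (X := B.bimodule) (Y := B.bimodule) x y) =
        (comul adj ≫ (x ▷ (aL ≫ a) ≫ (aL ≫ a) ◁ y) : aL ≫ a ⟶ (aL ≫ a) ≫ aL ≫ a) := by
    intro x y
    have t := NatTrans.IsMonoidal.tensor (τ := e.hom) g g
    rw [ι_homFunctor_μ] at t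
    have t' := DFunLike.congr_fun t
      (BimodCat.Tensor.tmul (X := B.bimodule) (Y := B.bimodule) x y)
    refine (he (g ⊗ g) _).symm.trans (t'.trans ?_)
    exact congrArg₂ (fun u v : aL ≫ a ⟶ aL ≫ a => comul adj ≫ (u ▷ (aL ≫ a) ≫ (aL ≫ a) ◁ v))
      (he g x) (he g y)
  have hε : ∀ r : a ⟶ a, ε'.hom r = (Bicategory.whiskerLeft aL r ≫ adj.counit : aL ≫ a ⟶ 𝟙 M) := by
    intro r
    have t := NatTrans.IsMonoidal.unit (τ := e.hom)
    rw [ι_homFunctor_ε] at t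
    exact (he (𝟙_ _) _).symm.trans (DFunLike.congr_fun t r)
  refine eq_endBialgebroid adj h B (fun r => ?_) (fun r => ?_) (fun f hf w => ?_) fun w => ?_
  -- At the identity of g, the right action of r is s(r) for B and a^L r for F; the left action
  -- gives t(r) in the same way.
  · have t := BimodCat.hom_op_smul (e.hom.app g) r (𝟙 (aL ≫ a))
    let s : aL ≫ a ⟶ aL ≫ a := B.source r
    exact (Category.comp_id s).symm.trans ((he g (s ≫ 𝟙 _)).symm.trans (t.trans
      ((congrArg (fun z : aL ≫ a ⟶ aL ≫ a => Bicategory.whiskerLeft aL r ≫ z)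
        (he g (𝟙 _))).trans (Category.comp_id _))))
  · have t := BimodCat.hom_smul (e.hom.app g) r (𝟙 (aL ≫ a))
    let s : aL ≫ a ⟶ aL ≫ a := B.target (.op r)
    exact (Category.comp_id s).symm.trans ((he g (s ≫ 𝟙 _)).symm.trans (t.trans
      ((congrArg (fun z : aL ≫ a ⟶ aL ≫ a => Bicategory.whiskerRight (leftDual adj r) a ≫ z)
        (he g (𝟙 _))).trans (Category.comp_id _))))
  · have hf' : f = μ'.hom.toAddMonoidHom :=
      BimodCat.Tensor.addHom_ext fun x y => (hf x y).trans (hμ x y).symm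
    -- Linearity at 1 ⊗ 1: the left side is μ(γ(w)), the right side w followed by μ(1 ⊗ 1) = δ.
    have t := μ'.hom.map_smul (.op (show End (aL ≫ a) from w))
      (BimodCat.Tensor.tmul (X := B.bimodule) (Y := B.bimodule) (𝟙 (aL ≫ a)) (𝟙 (aL ≫ a)))
    refine (DFunLike.congr_fun hf' _).trans
      ((congrArg μ'.hom (smul_one_tmul_one B w).symm).trans (t.trans ?_))
    refine (congrArg (fun z : aL ≫ a ⟶ (aL ≫ a) ≫ aL ≫ a => w ≫ z) (hμ (𝟙 _) (𝟙 _))).trans ?_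
    rw [id_whiskerRight, whiskerLeft_id, Category.comp_id]
    exact congrArg _ (Category.comp_id _)
  -- Linearity at 1 in R: ν(π(w)) is w followed by ν(1) = ε.
  · have t := ε'.hom.map_smul (.op (show End (aL ≫ a) from w)) (1 : End a)
    refine (hε _).symm.trans ((congrArg ε'.hom (smul_one_tensorUnit B w).symm).trans (t.trans ?_))
    refine (congrArg (fun z : aL ≫ a ⟶ 𝟙 M => w ≫ z) (hε (𝟙 a))).trans ?_
    rw [Bicategory.whiskerLeft_id, Category.id_comp]

end DepthTwo

/-! ### Existence and uniqueness combined. -/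

theorem mainTheorem1 {C : Type u} [Bicategory.{w, v} C] [PreadditiveBicategory C]
    [∀ M N : C, Limits.HasFiniteBiproducts (M ⟶ N)]
    [∀ M N : C, IsIdempotentComplete (M ⟶ N)]
    {N M : C} (a : N ⟶ M) (aL : M ⟶ N) (adj : Bicategory.Adjunction a aL)
    (depth_two : DepthTwo.IsDepthTwo adj)
    (unit_summand : Nonempty (Retract (𝟙 M) (aL ≫ a))) :
    ∃ _ : (DepthTwo.Cg adj).IsMonoidal,
      ∃! B : Bialgebroid (End a) (End (aL ≫ a)),
        ∃ (_ : B.fgp.IsMonoidal)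
          (mem_fgp : ∀ b : (DepthTwo.Cg adj).FullSubcategory,
            B.fgp (((DepthTwo.Cg adj).ι ⋙ DepthTwo.homMod B).obj b))
          (_ : (B.fgp.lift ((DepthTwo.Cg adj).ι ⋙ DepthTwo.homMod B) mem_fgp).Monoidal)
          (e : B.fgp.lift ((DepthTwo.Cg adj).ι ⋙ DepthTwo.homMod B) mem_fgp ⋙
              B.fgp.ι ⋙ B.forget ≅
            (DepthTwo.Cg adj).ι ⋙ DepthTwo.homFunctor adj),
          (B.fgp.lift ((DepthTwo.Cg adj).ι ⋙ DepthTwo.homMod B) mem_fgp).IsEquivalence ∧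
            (∀ (b : (DepthTwo.Cg adj).FullSubcategory) (x : aL ≫ a ⟶ b.obj),
              e.hom.app b x = x) ∧
            NatTrans.IsMonoidal e.hom := by
  have h : FactorsThrough a (a ≫ aL ≫ a) := summandOfMultiple_iff.1 depth_two
  have h₁ : FactorsThrough (aL ≫ a) (𝟙 M) := .of_retract unit_summand.some
  have hCg := DepthTwo.cg_isMonoidal adj h h₁
  refine ⟨hCg, DepthTwo.endBialgebroid adj h, ?_, ?_⟩
  · have hfgp := DepthTwo.fgp_isMonoidal adj h h₁
    exact ⟨hfgp, DepthTwo.homFgp_mem adj _, DepthTwo.homFgpMonoidal adj h,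
      DepthTwo.homFgpIso adj h, DepthTwo.homFgp_isEquivalence adj _ _, fun _ _ => rfl,
      DepthTwo.homFgpIso_isMonoidal adj h⟩
  · rintro B ⟨hfgp, mem, hmon, e, -, he, he'⟩
    exact DepthTwo.eq_endBialgebroid_of_isMonoidal adj h B mem e he
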